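/- All varieties are over $\mathbb{C}$; an affine variety is a reduced affine scheme of finite type over $\mathbb{C}$ (not assumed irreducible or connected, so irreducible varieties are included). A polynomial curve in an affine variety $X$ is the image of a non-constant morphism $\mathbb{A}^1_{\mathbb{C}}\to X$. An affine variety $X$ is called $\mathbb{C}$-uniruled if $\dim X\ge 1$ and there is a non-empty Zariski open subset $U\subseteq X$ such that for every (closed) point $x\in U$ there is a polynomial curve in $X$ passing through $x$. **Theorem.** Let $X$ be a smooth affine variety that is not $\mathbb{C}$-uniruled, let $r\ge 0$, and let $\mathbf{F},\mathbf{G}$ be algebraic vector bundles on $X$, both of rank $r$ (locally trivial in the Zariski topology). If the total space of $\mathbf{F}$ is isomorphic, as a variety over $\mathbb{C}$, to the total space of $\mathbf{G}$, then there is an automorphism $\sigma\in\operatorname{Aut}(X)$ of the variety $X$ over $\mathbb{C}$ such that $\mathbf{F}$ is isomorphic to $\sigma^*\mathbf{G}$ as an algebraic vector bundle on $X$. -/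

import Mathlib

open CategoryTheory CategoryTheory.Limits AlgebraicGeometry

noncomputable section

/-! ### Complex varieties and polynomial curves -/

/-- The point `Spec ℂ`. -/
abbrev SpecC : Scheme.{0} := Spec (CommRingCat.of ℂ)

/-- The affine line over `ℂ`, as a scheme over `Spec ℂ`. -/
def affineLineC : Over SpecC := Over.mk (𝔸(Fin 1; SpecC) ↘ SpecC)

/-- A polynomial curve in `X`: the image of a non-constant `ℂ`-morphism from the affine line. -/
def IsPolynomialCurve (X : Over SpecC) (C : Set X.left) : Prop :=
  ∃ φ : affineLineC ⟶ X, (∃ p q, φ.left p ≠ φ.left q) ∧ C = Set.range φ.left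

/-- `X` is `ℂ`-uniruled: it has dimension at least one, and there is a non-empty Zariski open
subset `U` such that through every (closed) point of `U` there passes a polynomial curve in `X`.
Closed points of the scheme are the points of the variety in the classical sense. -/
def IsCUniruled (X : Over SpecC) : Prop :=
  1 ≤ topologicalKrullDim X.left ∧
    ∃ U : X.left.Opens, (U : Set X.left).Nonempty ∧
      ∀ x ∈ U, IsClosed ({x} : Set X.left) → ∃ C, IsPolynomialCurve X C ∧ x ∈ C

/-! ### Algebraic vector bundles -/

/-- A local trivialization of `π : E ⟶ X` of rank `r`: an open subset `U` of `X` and an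
isomorphism `π⁻¹(U) ≅ U × 𝔸ʳ` over `U`. -/
structure BundleChart {X E : Scheme.{0}} (π : E ⟶ X) (r : ℕ) where
  /-- the open set `U` over which the chart is defined -/
  base : X.Opens
  /-- the isomorphism `π⁻¹(U) ≅ U × 𝔸ʳ` -/
  triv : (π ⁻¹ᵁ base).toScheme ≅ 𝔸(Fin r; base.toScheme)
  /-- the isomorphism is over `U` -/
  triv_over : triv.hom ≫ 𝔸(Fin r; base.toScheme) ↘ base.toScheme = π ∣_ base

namespace BundleChart

variable {X E : Scheme.{0}} {π : E ⟶ X} {r : ℕ}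

/-- The `k`-th fibre coordinate of a chart, a regular function on `π⁻¹(U)`. -/
def coord (c : BundleChart π r) (k : Fin r) : Γ(E, π ⁻¹ᵁ c.base) :=
  (π ⁻¹ᵁ c.base).topIso.hom (c.triv.hom.appTop (AffineSpace.coord _ k))

end BundleChart

/-- A morphism `f : E ⟶ E'` over `X` is linear with respect to the charts `c` of `E` (with fibre
coordinates `y`) and `d` of `E'` (with fibre coordinates `y'`) if, locally on the intersection of
the two base sets, `f` is of the form `(x, y) ↦ (x, A(x) y)` for a matrix `A` of regular functions
on the base: `f^* y'_k = ∑ l, A_{kl} y_l`. (The matrix is unique, so that the local matrices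
glue to one on the whole intersection.) -/
def BundleChart.LinearIn {X E E' : Scheme.{0}} {π : E ⟶ X} {π' : E' ⟶ X} {r r' : ℕ}
    (c : BundleChart π r) (d : BundleChart π' r') (f : E ⟶ E') (w : f ≫ π' = π) : Prop :=
  ∀ x ∈ c.base ⊓ d.base, ∃ (V : X.Opens) (_ : x ∈ V) (hc : V ≤ c.base) (hd : V ≤ d.base)
    (A : Matrix (Fin r') (Fin r) Γ(X, V)), ∀ k : Fin r',
      f.appLE (π' ⁻¹ᵁ d.base) (π ⁻¹ᵁ V) (by subst w; exact fun _ h => hd h) (d.coord k) =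
        ∑ l, π.app V (A k l) *
          E.presheaf.map (homOfLE (π.preimage_mono hc)).op (c.coord l)

/-- An algebraic vector bundle of rank `r` on `X`: a scheme `total` (the total space) with a
projection to `X` and an atlas of local trivializations over Zariski open sets that cover `X`,
with linear transition maps. -/
structure AlgVectorBundle (X : Scheme.{0}) (r : ℕ) where
  /-- the total space -/
  total : Scheme.{0}
  /-- the projection -/
  proj : total ⟶ X
  /-- the local trivializations -/
  atlas : Set (BundleChart proj r)
  /-- the local trivializations cover the base -/
  cover : ∀ x : X, ∃ c ∈ atlas, x ∈ c.base
  /-- the transition maps are linear -/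
  transition : ∀ c ∈ atlas, ∀ d ∈ atlas, c.LinearIn d (𝟙 total) (Category.id_comp _)

namespace AlgVectorBundle

variable {X : Scheme.{0}} {r : ℕ}

/-- A morphism of vector bundles on `X`: a morphism of total spaces over `X` that is linear in
all local trivializations. -/
structure Hom (F G : AlgVectorBundle X r) where
  /-- the morphism of total spaces -/
  map : F.total ⟶ G.total
  /-- it is a morphism over `X` -/
  w : map ≫ G.proj = F.proj
  /-- it is fibrewise linear -/
  linear : ∀ c ∈ F.atlas, ∀ d ∈ G.atlas, c.LinearIn d map w

/-- Two vector bundles on `X` are isomorphic: there are mutually inverse morphisms of vector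
bundles between them. -/
def Isomorphic (F G : AlgVectorBundle X r) : Prop :=
  ∃ (f : Hom F G) (g : Hom G F), f.map ≫ g.map = 𝟙 F.total ∧ g.map ≫ f.map = 𝟙 G.total

end AlgVectorBundle

namespace BundleChart

variable {X Y E : Scheme.{0}} {π : E ⟶ X} {r : ℕ}

theorem pullback_aux (c : BundleChart π r) (σ : Y ⟶ X) :
    pullback.snd π σ ⁻¹ᵁ (σ ⁻¹ᵁ c.base) ≤ pullback.fst π σ ⁻¹ᵁ (π ⁻¹ᵁ c.base) := by
  rw [← Scheme.Hom.comp_preimage, ← Scheme.Hom.comp_preimage, pullback.condition]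

/-- Over `σ⁻¹(U)`, the fibre product `E ×_X Y` is the fibre product of `π⁻¹(U)` and `σ⁻¹(U)`
over `U`. -/
theorem isPullback_restrict (c : BundleChart π r) (σ : Y ⟶ X) :
    IsPullback
      ((pullback.fst π σ).resLE (π ⁻¹ᵁ c.base) (pullback.snd π σ ⁻¹ᵁ (σ ⁻¹ᵁ c.base))
        (c.pullback_aux σ) ≫ c.triv.hom)
      (pullback.snd π σ ∣_ (σ ⁻¹ᵁ c.base))
      (𝔸(Fin r; c.base.toScheme) ↘ c.base.toScheme) (σ ∣_ c.base) := by
  have h := Scheme.Hom.isPullback_resLE (IsPullback.of_hasPullback π σ)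
    (US := c.base) (UT := σ ⁻¹ᵁ c.base) (UX := π ⁻¹ᵁ c.base)
    (UY := pullback.snd π σ ⁻¹ᵁ (σ ⁻¹ᵁ c.base)) le_rfl le_rfl
    (inf_eq_right.mpr (c.pullback_aux σ)).symm
  simp only [Scheme.Hom.resLE_eq_morphismRestrict] at h
  refine h.of_iso (Iso.refl _) c.triv (Iso.refl _) (Iso.refl _) ?_ ?_ ?_ ?_
  · simp
  · simp
  · simp [c.triv_over]
  · simp

/-- The chart `(x, v) ↦ (x, A v)` of `E ×_X Y` over `σ⁻¹(U)` induced by a chart of `E` over `U`: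
the fibre coordinates are the pulled back fibre coordinates. -/
def pullback (c : BundleChart π r) (σ : Y ⟶ X) : BundleChart (pullback.snd π σ) r where
  base := σ ⁻¹ᵁ c.base
  triv := (c.isPullback_restrict σ).isoIsPullback _ _
    (AffineSpace.isPullback_map (n := Fin r) (σ ∣_ c.base))
  triv_over := IsPullback.isoIsPullback_hom_snd _ _ _ _

theorem pullback_coord (c : BundleChart π r) (σ : Y ⟶ X) (k : Fin r) :
    (c.pullback σ).coord k =
      (pullback.fst π σ).appLE (π ⁻¹ᵁ c.base) (pullback.snd π σ ⁻¹ᵁ (σ ⁻¹ᵁ c.base))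
        (c.pullback_aux σ) (c.coord k) := by
  have h := IsPullback.isoIsPullback_hom_fst _ _ (c.isPullback_restrict σ)
    (AffineSpace.isPullback_map (n := Fin r) (σ ∣_ c.base))
  have h2 := congrArg (fun φ => φ.appTop (AffineSpace.coord _ k)) h
  simp only [Scheme.Hom.comp_appTop, CommRingCat.comp_apply,
    AffineSpace.map_appTop_coord] at h2
  have h3 : (c.pullback σ).triv.hom.appTop (AffineSpace.coord _ k) = _ := h2
  rw [coord, coord, h3, Scheme.Hom.appTop, Scheme.Hom.resLE_app_top]
  simp only [CommRingCat.comp_apply]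
  erw [Iso.inv_hom_id_apply]

/-- Linearity of a change of charts is preserved by pullback. -/
theorem LinearIn.pullback {c d : BundleChart π r}
    (H : c.LinearIn d (𝟙 E) (Category.id_comp _)) (σ : Y ⟶ X) :
    (c.pullback σ).LinearIn (d.pullback σ) (𝟙 _) (Category.id_comp _) := by
  intro y hy
  obtain ⟨V, hV, hVc, hVd, A, hA⟩ := H (σ y) hy
  refine ⟨σ ⁻¹ᵁ V, hV, σ.preimage_mono hVc, σ.preimage_mono hVd,
    fun k l => σ.app V (A k l), fun k => ?_⟩
  have hle : pullback.snd π σ ⁻¹ᵁ (σ ⁻¹ᵁ V) ≤ pullback.fst π σ ⁻¹ᵁ (π ⁻¹ᵁ V) := by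
    rw [← Scheme.Hom.comp_preimage, ← Scheme.Hom.comp_preimage, pullback.condition]
  have m1 : (pullback.fst π σ).appLE (π ⁻¹ᵁ d.base) (pullback.snd π σ ⁻¹ᵁ (σ ⁻¹ᵁ d.base))
        (d.pullback_aux σ) ≫
      Scheme.Hom.appLE (𝟙 (Limits.pullback π σ)) (pullback.snd π σ ⁻¹ᵁ (σ ⁻¹ᵁ d.base))
        (pullback.snd π σ ⁻¹ᵁ (σ ⁻¹ᵁ V))
        ((pullback.snd π σ).preimage_mono (σ.preimage_mono hVd)) =
      Scheme.Hom.appLE (𝟙 E) (π ⁻¹ᵁ d.base) (π ⁻¹ᵁ V) (π.preimage_mono hVd) ≫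
        (pullback.fst π σ).appLE (π ⁻¹ᵁ V) (pullback.snd π σ ⁻¹ᵁ (σ ⁻¹ᵁ V)) hle := by
    erw [Scheme.Hom.appLE_comp_appLE, Scheme.Hom.appLE_comp_appLE]
    simp only [Category.id_comp, Category.comp_id]
  have m2 : σ.app V ≫ (pullback.snd π σ).app (σ ⁻¹ᵁ V) =
      π.app V ≫ (pullback.fst π σ).appLE (π ⁻¹ᵁ V) (pullback.snd π σ ⁻¹ᵁ (σ ⁻¹ᵁ V)) hle := by
    rw [Scheme.Hom.app_eq_appLE, Scheme.Hom.app_eq_appLE, Scheme.Hom.app_eq_appLE,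
      Scheme.Hom.appLE_comp_appLE, Scheme.Hom.appLE_comp_appLE]
    simp only [pullback.condition]
  have m3 : (pullback.fst π σ).appLE (π ⁻¹ᵁ c.base) (pullback.snd π σ ⁻¹ᵁ (σ ⁻¹ᵁ c.base))
        (c.pullback_aux σ) ≫ (Limits.pullback π σ).presheaf.map
          (homOfLE ((pullback.snd π σ).preimage_mono (σ.preimage_mono hVc))).op =
      E.presheaf.map (homOfLE (π.preimage_mono hVc)).op ≫
        (pullback.fst π σ).appLE (π ⁻¹ᵁ V) (pullback.snd π σ ⁻¹ᵁ (σ ⁻¹ᵁ V)) hle := by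
    rw [Scheme.Hom.appLE_map, Scheme.Hom.map_appLE]
  have h := congrArg ((pullback.fst π σ).appLE (π ⁻¹ᵁ V) _ hle) (hA k)
  rw [map_sum] at h
  simp only [pullback_coord]
  refine (congr($m1 (d.coord k))).trans (h.trans (Finset.sum_congr rfl fun l _ => ?_))
  refine (map_mul _ _ _).trans (congrArg₂ (· * ·) ?_ ?_)
  · exact (congr($m2 (A k l))).symm
  · exact (congr($m3 (c.coord l))).symm

end BundleChart

namespace AlgVectorBundle

variable {X Y : Scheme.{0}} {r : ℕ}

/-- The pullback `σ^*G` of a vector bundle along `σ : Y ⟶ X`: its total space is the fibre product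
`G ×_X Y`, with the induced local trivializations. -/
def pullback (G : AlgVectorBundle X r) (σ : Y ⟶ X) : AlgVectorBundle Y r where
  total := Limits.pullback G.proj σ
  proj := pullback.snd G.proj σ
  atlas := (fun c => c.pullback σ) '' G.atlas
  cover y := by
    obtain ⟨c, hc, hy⟩ := G.cover (σ y)
    exact ⟨_, ⟨c, hc, rfl⟩, hy⟩
  transition := by
    rintro _ ⟨c, hc, rfl⟩ _ ⟨d, hd, rfl⟩
    exact (G.transition c hc d hd).pullback σ

/-- The total space of a vector bundle on a scheme over `ℂ`, as a scheme over `ℂ`. -/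
def totalSpace {X : Over SpecC} (F : AlgVectorBundle X.left r) : Over SpecC :=
  Over.mk (F.proj ≫ X.hom)

end AlgVectorBundle

end

noncomputable section

/-! ### Linear parts with respect to polynomial coordinates -/

namespace MvPolynomial

variable {R : Type*} [CommRing R] {σ τ : Type*}

/-! An isomorphism of total spaces is first shown to respect the fibrations and is then linearized
along the zero section.

Restricting the composite of `F.total ≅ G.total` with `G.proj` to the line through a point of a
fibre and the origin gives a map from the affine line to `X`. If it is not constant, it exhibits a
polynomial curve through the image of the point. As `X` is not `ℂ`-uniruled, every non-empty open
set contains a closed point on no such curve (`exists_mem_curveFreePoints`). The composite is open,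
so over each chart it agrees, at a dense set of closed points, with its value at the origin of the
fibre. The source is reduced and the target separated, so it agrees everywhere
(`ι_comp_eq_zeroSection`) and descends to a map `X ⟶ X`. The inverse isomorphism descends too, and
the two maps are mutually inverse because bundle projections are epimorphisms. This is `σ`, and
`F.total` becomes isomorphic over `X` to the total space of `σ^*G`.

It remains to replace an isomorphism over `X` by a fibrewise linear one (`isomorphic_of_iso`). Over
an affine chart it is given by polynomials in the fibre coordinates. Their degree-one parts are
compatible with linear changes of coordinates, hence glue to a bundle map. Its matrix is the
Jacobian at the origin of a polynomial automorphism, invertible by the chain rule even when the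
origin is not fixed. -/

theorem coeff_single_one_eq (m : σ) (p : MvPolynomial σ R) :
    coeff (Finsupp.single m 1) p = constantCoeff (pderiv m p) := by
  simp [constantCoeff_eq, coeff_pderiv]

theorem coeff_single_sum_C_mul_X [Fintype σ] (a : σ → R) (l : σ) :
    coeff (Finsupp.single l 1) (∑ l, C (a l) * X l) = a l := by
  classical
  rw [coeff_sum, Finset.sum_eq_single l]
  · simp
  · intro b _ hb
    rw [coeff_C_mul, coeff_X, if_neg, mul_zero]
    exact fun h => hb (Finsupp.single_left_injective one_ne_zero h)
  · simp

theorem homogeneousComponent_one_eq [Fintype σ] (p : MvPolynomial σ R) :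
    homogeneousComponent 1 p = ∑ l, C (coeff (Finsupp.single l 1) p) * X l := by
  have h := homogeneousComponent_mem 1 p
  rw [homogeneousSubmodule_one_eq_span_X, Submodule.mem_span_range_iff_exists_fun] at h
  obtain ⟨a, ha⟩ := h
  simp only [smul_eq_C_mul] at ha
  have hl : ∀ l, coeff (Finsupp.single l 1) p = a l := fun l => by
    rw [← coeff_single_sum_C_mul_X a l, ha, coeff_homogeneousComponent, if_pos (by simp)]
  simp only [hl, ha]

/-- Substituting linear forms without constant term preserves degrees. This is why linear parts
survive a linear change of fibre coordinates. -/
theorem homogeneousComponent_eval₂ {R' : Type*} [CommRing R'] (ρ : R →+* R')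
    (g : σ → MvPolynomial τ R') (hg : ∀ l, (g l).IsHomogeneous 1) (n : ℕ)
    (p : MvPolynomial σ R) :
    homogeneousComponent n (eval₂ (C.comp ρ) g p) =
      eval₂ (C.comp ρ) g (homogeneousComponent n p) := by
  have key : ∀ i, (eval₂ (C.comp ρ) g (homogeneousComponent i p)).IsHomogeneous i := fun i => by
    have h := (homogeneousComponent_isHomogeneous i p).eval₂ (C.comp ρ) g
      (fun r => isHomogeneous_C _ _) hg
    rwa [one_mul] at h
  conv_lhs => rw [← sum_homogeneousComponent p]
  rw [← coe_eval₂Hom, map_sum, map_sum]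
  simp only [coe_eval₂Hom]
  have hi : ∀ i, homogeneousComponent n (eval₂ (C.comp ρ) g (homogeneousComponent i p)) =
      if n = i then eval₂ (C.comp ρ) g (homogeneousComponent i p) else 0 := fun i =>
    homogeneousComponent_of_mem ((mem_homogeneousSubmodule _ _).mpr (key i))
  simp only [hi, Finset.sum_ite_eq]
  split_ifs with h
  · rfl
  · have hn : p.totalDegree < n := by
      rw [Finset.mem_range] at h
      omega
    rw [homogeneousComponent_eq_zero _ _ hn, eval₂_zero]

/-- The chain rule at the origin. -/
theorem coeff_single_algHom [Fintype σ] (α : MvPolynomial σ R →ₐ[R] MvPolynomial τ R) (m : τ)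
    (q : MvPolynomial σ R) :
    coeff (Finsupp.single m 1) (α q) =
      ∑ k, eval (fun k => constantCoeff (α (X k))) (pderiv k q) *
        coeff (Finsupp.single m 1) (α (X k)) := by
  classical
  -- Evaluation at the origin after `α` is evaluation at the image of the origin, which need not be
  -- the origin.
  have hev : ∀ q, constantCoeff (α q) = eval (fun k => constantCoeff (α (X k))) q := by
    intro q
    induction q using MvPolynomial.induction_on with
    | C a => rw [← algebraMap_eq, α.commutes]; simp [algebraMap_eq]
    | add p q hp hq => simp [hp, hq]
    | mul_X p k hp => simp [hp]
  simp only [coeff_single_one_eq]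
  induction q using MvPolynomial.induction_on with
  | C a => rw [← algebraMap_eq, α.commutes]; simp
  | add p q hp hq => simp only [map_add, hp, hq, add_mul, Finset.sum_add_distrib]
  | mul_X p j hp =>
    rw [map_mul, pderiv_mul, map_add, map_mul, map_mul, hp, hev, Finset.sum_mul]
    simp only [pderiv_mul, map_add, map_mul, eval_X, add_mul, Finset.sum_add_distrib]
    congr 1
    · exact Finset.sum_congr rfl fun k _ => by ring
    · rw [Finset.sum_eq_single j]
      · rw [pderiv_X_self, map_one, mul_one, hev p]
      · intro b _ hb
        simp [pderiv_X_of_ne hb.symm]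
      · simp

/-- By the chain rule, the Jacobian of the inverse at the image of the origin is a left inverse of
this matrix; for square matrices one side suffices. -/
theorem isUnit_linearCoeff [Fintype σ] [DecidableEq σ]
    (α : MvPolynomial σ R ≃ₐ[R] MvPolynomial σ R) :
    IsUnit (Matrix.of fun k l => coeff (Finsupp.single l 1) (α (X k))) := by
  refine IsUnit.of_mul_eq_one_right (Matrix.of fun l k =>
    eval (fun k => constantCoeff (α (X k))) (pderiv k (α.symm (X l)))) ?_
  ext l m
  have h := coeff_single_algHom α.toAlgHom m (α.symm (X l))
  simp only [AlgEquiv.toAlgHom_apply, AlgEquiv.apply_symm_apply] at h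
  simp only [Matrix.mul_apply, Matrix.of_apply]
  refine Eq.trans h.symm ?_
  rw [coeff_X, Matrix.one_apply]
  exact if_congr ⟨fun h => Finsupp.single_left_injective one_ne_zero h, fun h => h ▸ rfl⟩ rfl rfl

end MvPolynomial

open MvPolynomial in
/-- `t` is the linear part of `s`, where both are expressed as polynomials in `y` with
coefficients in `R`. -/
def IsLinearPart {R S σ : Type*} [CommRing R] [CommRing S] (φ : R →+* S) (y : σ → S)
    (s t : S) : Prop :=
  ∃ p : MvPolynomial σ R, eval₂Hom φ y p = s ∧ eval₂Hom φ y (homogeneousComponent 1 p) = t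

namespace IsLinearPart

open MvPolynomial

variable {R S σ : Type*} [CommRing R] [CommRing S] {φ : R →+* S} {y : σ → S} {s t s' t' : S}

theorem unique (h : Function.Injective (eval₂Hom φ y)) (H : IsLinearPart φ y s t)
    (H' : IsLinearPart φ y s t') : t = t' := by
  obtain ⟨p, rfl, rfl⟩ := H
  obtain ⟨q, hq, rfl⟩ := H'
  rw [h hq]

/-- Handles a linear change of chart on the target, as `map` does on the source. -/
theorem sum_mul {ι : Type*} (A : Finset ι) (a : ι → R) {s t : ι → S}
    (H : ∀ i ∈ A, IsLinearPart φ y (s i) (t i)) :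
    IsLinearPart φ y (∑ i ∈ A, φ (a i) * s i) (∑ i ∈ A, φ (a i) * t i) := by
  classical
  induction A using Finset.induction_on with
  | empty => exact ⟨0, by simp, by simp⟩
  | insert i A hi ih =>
    obtain ⟨p, hp, hp'⟩ := ih fun j hj => H j (Finset.mem_insert_of_mem hj)
    obtain ⟨q, hq, hq'⟩ := H i (Finset.mem_insert_self _ _)
    refine ⟨C (a i) * q + p, ?_, ?_⟩
    · rw [Finset.sum_insert hi, map_add, map_mul, hp, hq]; simp
    · rw [Finset.sum_insert hi, map_add, map_add, homogeneousComponent_C_mul, map_mul, hp', hq']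
      simp

/-- Linear parts are compatible with ring extensions and linear changes of coordinates. -/
theorem map {R' S' τ : Type*} [CommRing R'] [CommRing S'] {φ' : R' →+* S'} {y' : τ → S'}
    [Fintype τ] (ρ : R →+* R') (ρ' : S →+* S') (hρ : ∀ a, ρ' (φ a) = φ' (ρ a))
    (T : σ → τ → R') (hT : ∀ l, ρ' (y l) = ∑ m, φ' (T l m) * y' m)
    (H : IsLinearPart φ y s t) : IsLinearPart φ' y' (ρ' s) (ρ' t) := by
  obtain ⟨p, rfl, rfl⟩ := H
  -- If `q` represents an element in the coordinates `y`, substituting the linear forms given by `T`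
  -- represents its image in the coordinates `y'`.
  have key : ∀ q, eval₂Hom φ' y' (eval₂ (C.comp ρ) (fun l => ∑ m, C (T l m) * X m) q) =
      ρ' (eval₂Hom φ y q) := by
    intro q
    induction q using MvPolynomial.induction_on with
    | C a => simp [hρ]
    | add p q hp hq => rw [eval₂_add, map_add, hp, hq, map_add, map_add]
    | mul_X p k hp => rw [eval₂_mul, map_mul, hp, map_mul, map_mul]; simp [hT]
  refine ⟨_, key p, ?_⟩
  rw [homogeneousComponent_eval₂ ρ _ (fun l => ?_), key]
  exact IsHomogeneous.sum _ _ _ fun m _ => isHomogeneous_C_mul_X _ _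

theorem exists_eq_sum [Fintype σ] (h : Function.Surjective (eval₂Hom φ y)) (s : S) :
    ∃ a : σ → R, IsLinearPart φ y s (∑ l, φ (a l) * y l) := by
  obtain ⟨p, rfl⟩ := h s
  refine ⟨fun l => coeff (Finsupp.single l 1) p, p, rfl, ?_⟩
  simp [homogeneousComponent_one_eq, map_sum]

/-- The matrix of the linear part of an isomorphism of polynomial rings is invertible. -/
theorem isUnit_matrix {S' : Type*} [CommRing S'] [Fintype σ] [DecidableEq σ] {φ' : R →+* S'}
    {y' : σ → S'} (h : Function.Bijective (eval₂Hom φ y))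
    (h' : Function.Bijective (eval₂Hom φ' y')) (ψ : S' ≃+* S) (hψ : ∀ a, ψ (φ' a) = φ a)
    (A : Matrix σ σ R) (hA : ∀ k, IsLinearPart φ y (ψ (y' k)) (∑ l, φ (A k l) * y l)) :
    IsUnit A := by
  let e := RingEquiv.ofBijective _ h
  let e' := RingEquiv.ofBijective _ h'
  -- `α` is `ψ` read in the two polynomial coordinate systems; it is `R`-linear by `hψ`.
  let α : MvPolynomial σ R ≃ₐ[R] MvPolynomial σ R :=
    AlgEquiv.ofRingEquiv (f := (e'.trans ψ).trans e.symm) (fun r => by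
      simp only [RingEquiv.trans_apply]
      rw [RingEquiv.symm_apply_eq]
      simp [e, e', algebraMap_eq, hψ])
  have hα : ∀ k, eval₂Hom φ y (α (X k)) = ψ (y' k) := fun k => by
    change e (e.symm (ψ (e' (X k)))) = _
    simp [e']
  convert isUnit_linearCoeff α
  ext k l
  obtain ⟨p, hp, hp'⟩ := hA k
  have hpα : p = α (X k) := h.1 (hp.trans (hα k).symm)
  have : homogeneousComponent 1 p = ∑ l, C (A k l) * X l :=
    h.1 (hp'.trans (by simp [map_sum]))
  have h2 := congrArg (coeff (Finsupp.single l 1)) this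
  rw [coeff_homogeneousComponent, if_pos (by simp), hpα, coeff_single_sum_C_mul_X] at h2
  exact h2.symm

end IsLinearPart

/-! ### Gluing morphisms along open covers -/

/-- Morphisms on the members of an open cover that agree locally on the overlaps glue. -/
theorem AlgebraicGeometry.Scheme.exists_glue {Y Z : Scheme.{0}} {ι : Type*} (W : ι → Y.Opens)
    (hW : ∀ y, ∃ i, y ∈ W i) (h : ∀ i, (W i).toScheme ⟶ Z)
    (compat : ∀ i j, ∀ y ∈ W i ⊓ W j, ∃ (N : Y.Opens) (_ : y ∈ N) (hi : N ≤ W i) (hj : N ≤ W j),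
      Y.homOfLE hi ≫ h i = Y.homOfLE hj ≫ h j) :
    ∃ g : Y ⟶ Z, ∀ i, (W i).ι ≫ g = h i := by
  -- One member is chosen per point, so the cover is indexed by `Y` whatever the universe of `ι`.
  -- Agreement with the members not chosen is recovered from `compat`.
  choose k hk using hW
  let 𝒰 : Y.OpenCover := Y.openCoverOfIsOpenCover (fun y => W (k y))
    (by rw [TopologicalSpace.IsOpenCover, eq_top_iff]
        exact fun y _ => TopologicalSpace.Opens.mem_iSup.mpr ⟨y, hk y⟩)
  have h1 : ∀ i j, Limits.pullback.fst (W i).ι (W j).ι ≫ h i =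
      Limits.pullback.snd (W i).ι (W j).ι ≫ h j := by
    intro i j
    refine Scheme.hom_ext_of_forall _ _ fun p => ?_
    set q : Limits.pullback (W i).ι (W j).ι ⟶ Y := pullback.fst (W i).ι (W j).ι ≫ (W i).ι with hq
    have hq' : q = pullback.snd (W i).ι (W j).ι ≫ (W j).ι := pullback.condition
    have hqp : q p ∈ W i ⊓ W j := by
      constructor
      · rw [hq, Scheme.Hom.comp_apply]; exact Subtype.property _
      · rw [hq', Scheme.Hom.comp_apply]; exact Subtype.property _
    obtain ⟨N, hN, hi, hj, e⟩ := compat i j _ hqp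
    refine ⟨q ⁻¹ᵁ N, hN, ?_⟩
    have ei : (q ⁻¹ᵁ N).ι ≫ pullback.fst (W i).ι (W j).ι = (q ∣_ N) ≫ Y.homOfLE hi := by
      rw [← cancel_mono (W i).ι]
      simp [hq]
    have ej : (q ⁻¹ᵁ N).ι ≫ pullback.snd (W i).ι (W j).ι = (q ∣_ N) ≫ Y.homOfLE hj := by
      rw [← cancel_mono (W j).ι]
      simp [hq']
    rw [reassoc_of% ei, e, reassoc_of% ej]
  refine ⟨Scheme.Cover.glueMorphisms 𝒰 (fun y => h (k y)) fun x y => h1 (k x) (k y), fun i => ?_⟩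
  refine Scheme.hom_ext_of_forall _ _ fun y => ?_
  have hy : y.1 ∈ W i ⊓ W (k y.1) := ⟨y.2, hk y.1⟩
  obtain ⟨N, hN, hi, hj, e⟩ := compat i (k y.1) y.1 hy
  have hg := Scheme.Cover.ι_glueMorphisms 𝒰 (fun y => h (k y)) (fun x y => h1 (k x) (k y)) y.1
  change (W (k y.1)).ι ≫ _ = _ at hg
  refine ⟨(W i).ι ⁻¹ᵁ N, hN, ?_⟩
  have e1 : ((W i).ι ⁻¹ᵁ N).ι ≫ (W i).ι = ((W i).ι ∣_ N) ≫ N.ι := by simp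
  have e2 : ((W i).ι ⁻¹ᵁ N).ι = ((W i).ι ∣_ N) ≫ Y.homOfLE hi := by
    rw [← cancel_mono (W i).ι]; simp
  rw [reassoc_of% e1, ← Y.homOfLE_ι hj, Category.assoc, hg, ← e, ← reassoc_of% e2]

theorem AlgebraicGeometry.Scheme.Opens.topIso_inv_eq_appLE {Y : Scheme.{0}} (W : Y.Opens) :
    W.topIso.inv = W.ι.appLE W ⊤ W.ι_preimage_self.ge := by
  rw [Scheme.Opens.ι_appLE, Scheme.Opens.topIso_inv]
  rfl

theorem AlgebraicGeometry.Scheme.Hom.appTop_eq_appLE {Y Z : Scheme.{0}} (f : Y ⟶ Z) :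
    f.appTop = f.appLE ⊤ ⊤ f.preimage_top.ge := by
  rw [Scheme.Hom.appTop, Scheme.Hom.app_eq_appLE]
  rfl

theorem AlgebraicGeometry.Scheme.Hom.isIso_appTop {Y Z : Scheme.{0}} (f : Y ⟶ Z) [IsIso f] :
    IsIso f.appTop :=
  inferInstanceAs (IsIso (Scheme.Γ.map f.op))

namespace BundleChart

variable {X E T : Scheme.{0}} {π : E ⟶ X} {r : ℕ}

/-! ### Morphisms into the domain of a chart -/

/-- The morphism `t ↦ (g(t), a(t))` into the domain of a chart. -/
def lift (c : BundleChart π r) (g : T ⟶ X) (hg : ∀ t, g t ∈ c.base) (a : Fin r → Γ(T, ⊤)) :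
    T ⟶ E :=
  AffineSpace.homOfVector (IsOpenImmersion.lift c.base.ι g
    (by rw [Scheme.Opens.range_ι]; rintro _ ⟨t, rfl⟩; exact hg t)) a ≫ c.triv.inv ≫
    (π ⁻¹ᵁ c.base).ι

theorem lift_proj (c : BundleChart π r) (g : T ⟶ X) (hg : ∀ t, g t ∈ c.base)
    (a : Fin r → Γ(T, ⊤)) : c.lift g hg a ≫ π = g := by
  have h : c.triv.inv ≫ (π ∣_ c.base) = 𝔸(Fin r; c.base.toScheme) ↘ c.base.toScheme := by
    rw [← c.triv_over, Iso.inv_hom_id_assoc]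
  rw [lift, Category.assoc, Category.assoc, ← morphismRestrict_ι, reassoc_of% h,
    AffineSpace.homOfVector_over_assoc, IsOpenImmersion.lift_fac]

theorem lift_mem (c : BundleChart π r) (g : T ⟶ X) (hg : ∀ t, g t ∈ c.base)
    (a : Fin r → Γ(T, ⊤)) : ⊤ ≤ c.lift g hg a ⁻¹ᵁ (π ⁻¹ᵁ c.base) := by
  rw [← Scheme.Hom.comp_preimage, lift_proj]
  exact fun t _ => hg t

theorem appLE_coord (c : BundleChart π r) (h : T ⟶ (π ⁻¹ᵁ c.base).toScheme) (e) (k : Fin r) :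
    (h ≫ (π ⁻¹ᵁ c.base).ι).appLE (π ⁻¹ᵁ c.base) ⊤ e (c.coord k) =
      (h ≫ c.triv.hom).appTop (AffineSpace.coord _ k) := by
  have h1 : (h ≫ (π ⁻¹ᵁ c.base).ι).appLE (π ⁻¹ᵁ c.base) ⊤ e =
      (π ⁻¹ᵁ c.base).topIso.inv ≫ h.appTop := by
    rw [Scheme.Opens.topIso_inv_eq_appLE, Scheme.Hom.appTop_eq_appLE,
      Scheme.Hom.appLE_comp_appLE]
  rw [h1, coord, CommRingCat.comp_apply, Iso.hom_inv_id_apply, Scheme.Hom.comp_appTop,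
    CommRingCat.comp_apply]

theorem lift_coord (c : BundleChart π r) (g : T ⟶ X) (hg : ∀ t, g t ∈ c.base)
    (a : Fin r → Γ(T, ⊤)) (e) (k : Fin r) :
    (c.lift g hg a).appLE (π ⁻¹ᵁ c.base) ⊤ e (c.coord k) = a k := by
  have h := c.appLE_coord (AffineSpace.homOfVector (IsOpenImmersion.lift c.base.ι g
    (by rw [Scheme.Opens.range_ι]; rintro _ ⟨t, rfl⟩; exact hg t)) a ≫ c.triv.inv)
    (by simpa only [lift, Category.assoc] using e) k
  simp only [Category.assoc, Iso.inv_hom_id, Category.comp_id,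
    AffineSpace.homOfVector_appTop_coord] at h
  exact h

/-- A morphism into the domain of a chart is determined by its projection to the base and by the
pullbacks of the coordinates. -/
theorem hom_ext (c : BundleChart π r) {h h' : T ⟶ E} (w : h ≫ π = h' ≫ π)
    (hb : ⊤ ≤ h ⁻¹ᵁ (π ⁻¹ᵁ c.base)) (hb' : ⊤ ≤ h' ⁻¹ᵁ (π ⁻¹ᵁ c.base))
    (hc : ∀ k, h.appLE (π ⁻¹ᵁ c.base) ⊤ hb (c.coord k) =
      h'.appLE (π ⁻¹ᵁ c.base) ⊤ hb' (c.coord k)) : h = h' := by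
  have key : ∀ f : T ⟶ E, ⊤ ≤ f ⁻¹ᵁ (π ⁻¹ᵁ c.base) →
      ∃ f' : T ⟶ (π ⁻¹ᵁ c.base).toScheme, f = f' ≫ (π ⁻¹ᵁ c.base).ι := fun f hf =>
    ⟨IsOpenImmersion.lift (π ⁻¹ᵁ c.base).ι f
      (by rw [Scheme.Opens.range_ι]; rintro _ ⟨t, rfl⟩; exact hf trivial),
      (IsOpenImmersion.lift_fac _ _ _).symm⟩
  obtain ⟨h, rfl⟩ := key h hb
  obtain ⟨h', rfl⟩ := key h' hb'
  simp only [appLE_coord] at hc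
  congr 1
  rw [← cancel_mono c.triv.hom]
  refine AffineSpace.hom_ext ?_ hc
  rw [Category.assoc, Category.assoc, c.triv_over, ← cancel_mono c.base.ι]
  simpa using w

/-! ### Functions on the domain of a chart as polynomials -/

/-- The restriction of a fibre coordinate to a smaller open set. -/
def coordOn (c : BundleChart π r) {V : X.Opens} (hV : V ≤ c.base) (k : Fin r) : Γ(E, π ⁻¹ᵁ V) :=
  E.presheaf.map (homOfLE (π.preimage_mono hV)).op (c.coord k)

theorem appLE_coord_of_le (c : BundleChart π r) {V : X.Opens} (hV : V ≤ c.base)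
    (h : T ⟶ (π ⁻¹ᵁ V).toScheme) (e) (k : Fin r) :
    (h ≫ (π ⁻¹ᵁ V).ι).appLE (π ⁻¹ᵁ c.base) ⊤ e (c.coord k) =
      h.appTop ((π ⁻¹ᵁ V).topIso.inv (c.coordOn hV k)) := by
  have h1 : (h ≫ (π ⁻¹ᵁ V).ι).appLE (π ⁻¹ᵁ c.base) ⊤ e =
      E.presheaf.map (homOfLE (π.preimage_mono hV)).op ≫ (π ⁻¹ᵁ V).topIso.inv ≫ h.appTop := by
    rw [Scheme.Opens.topIso_inv_eq_appLE, Scheme.Hom.appTop_eq_appLE,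
      Scheme.Hom.appLE_comp_appLE, Scheme.Hom.map_appLE]
  rw [h1, coordOn, CommRingCat.comp_apply, CommRingCat.comp_apply]

theorem comp_lift {S : Scheme.{0}} (c : BundleChart π r) (f : S ⟶ T) (g : T ⟶ X)
    (hg : ∀ t, g t ∈ c.base) (a : Fin r → Γ(T, ⊤)) :
    f ≫ c.lift g hg a = c.lift (f ≫ g) (fun s => by rw [Scheme.Hom.comp_apply]; exact hg _)
      (fun k => f.appTop (a k)) := by
  rw [lift, ← Category.assoc, AffineSpace.comp_homOfVector, lift]
  congr 2
  rw [← cancel_mono c.base.ι]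
  simp

theorem lift_eq_of_le (c : BundleChart π r) {V : X.Opens} (hV : V ≤ c.base)
    (h : T ⟶ (π ⁻¹ᵁ V).toScheme) :
    c.lift (h ≫ (π ∣_ V) ≫ V.ι) (fun _ => hV (Subtype.property _))
      (fun k => h.appTop ((π ⁻¹ᵁ V).topIso.inv (c.coordOn hV k))) = h ≫ (π ⁻¹ᵁ V).ι := by
  have hle : ⊤ ≤ (h ≫ (π ⁻¹ᵁ V).ι) ⁻¹ᵁ (π ⁻¹ᵁ c.base) := by
    intro t _
    exact hV (Subtype.property (h t))
  refine c.hom_ext ?_ (c.lift_mem _ _ _) hle fun k => ?_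
  · rw [lift_proj]; simp
  · rw [lift_coord, appLE_coord_of_le]

/-- The isomorphism `π⁻¹(V) ≅ V × 𝔸ʳ` over an open set `V` contained in the domain of a chart. -/
def restrictIso (c : BundleChart π r) {V : X.Opens} (hV : V ≤ c.base) :
    (π ⁻¹ᵁ V).toScheme ≅ 𝔸(Fin r; V.toScheme) where
  hom := AffineSpace.homOfVector (π ∣_ V) fun k => (π ⁻¹ᵁ V).topIso.inv (c.coordOn hV k)
  inv := IsOpenImmersion.lift (π ⁻¹ᵁ V).ι
    (c.lift (𝔸(Fin r; V.toScheme) ↘ V.toScheme ≫ V.ι) (fun t => hV (Subtype.property _))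
      (AffineSpace.coord _))
    (by
      rw [Scheme.Opens.range_ι]
      rintro _ ⟨t, rfl⟩
      change π _ ∈ V
      rw [← Scheme.Hom.comp_apply, lift_proj]
      exact Subtype.property _)
  hom_inv_id := by
    rw [← cancel_mono (π ⁻¹ᵁ V).ι, Category.assoc, IsOpenImmersion.lift_fac, comp_lift]
    simp only [AffineSpace.homOfVector_over_assoc, AffineSpace.homOfVector_appTop_coord]
    simpa using c.lift_eq_of_le hV (𝟙 _)
  inv_hom_id := by
    refine AffineSpace.hom_ext ?_ fun k => ?_
    · rw [Category.assoc, AffineSpace.homOfVector_over, ← cancel_mono V.ι, Category.assoc,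
        morphismRestrict_ι, IsOpenImmersion.lift_fac_assoc, lift_proj, Category.id_comp]
    · rw [Scheme.Hom.comp_appTop, CommRingCat.comp_apply, AffineSpace.homOfVector_appTop_coord,
        ← appLE_coord_of_le]
      · simp only [IsOpenImmersion.lift_fac]
        rw [lift_coord]
        simp
      · rw [IsOpenImmersion.lift_fac]
        exact c.lift_mem _ _ _

/-- The functions on `π⁻¹(V)`, for `V` affine, are the polynomials in the fibre coordinates. -/
theorem bijective_eval₂Hom (c : BundleChart π r) {V : X.Opens} (hV : V ≤ c.base)
    (hV' : IsAffineOpen V) :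
    Function.Bijective (MvPolynomial.eval₂Hom (π.app V).hom (c.coordOn hV)) := by
  have : IsAffine V.toScheme := hV'
  let f : CommRingCat.of (MvPolynomial (Fin r) Γ(X, V)) ⟶ CommRingCat.of
      (MvPolynomial (Fin r) Γ(V.toScheme, ⊤)) :=
    CommRingCat.ofHom (MvPolynomial.map V.topIso.inv.hom)
  let g : CommRingCat.of (MvPolynomial (Fin r) Γ(V.toScheme, ⊤)) ⟶ Γ(𝔸(Fin r; V.toScheme), ⊤) :=
    (Scheme.ΓSpecIso _).inv ≫ (AffineSpace.isoOfIsAffine (Fin r) V.toScheme).hom.appTop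
  -- `h` is a composite of isomorphisms by construction. It is identified with the evaluation map by
  -- comparing constants and variables.
  let h := f ≫ g ≫ (c.restrictIso hV).hom.appTop ≫ (π ⁻¹ᵁ V).topIso.hom
  have hf : IsIso f := by
    rw [ConcreteCategory.isIso_iff_bijective]
    exact (MvPolynomial.mapEquiv _ V.topIso.symm.commRingCatIsoToRingEquiv).bijective
  have hg : IsIso g := IsIso.comp_isIso' inferInstance
    (Scheme.Hom.isIso_appTop _)
  have hg' : ∀ p, g p = MvPolynomial.eval₂Hom (𝔸(Fin r; V.toScheme) ↘ V.toScheme).appTop.hom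
      (AffineSpace.coord _) p := fun p => by
    simp only [g, AffineSpace.isoOfIsAffine_hom_appTop, Iso.inv_hom_id_assoc]
    rfl
  have hh : h.hom = MvPolynomial.eval₂Hom (π.app V).hom (c.coordOn hV) := by
    refine MvPolynomial.ringHom_ext (fun a => ?_) fun k => ?_
    · have h1 : V.topIso.inv ≫ (π ∣_ V).appTop = π.app V ≫ (π ⁻¹ᵁ V).topIso.inv := by
        rw [Scheme.Opens.topIso_inv_eq_appLE, Scheme.Opens.topIso_inv_eq_appLE,
          Scheme.Hom.appTop_eq_appLE, Scheme.Hom.app_eq_appLE, Scheme.Hom.appLE_comp_appLE,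
          Scheme.Hom.appLE_comp_appLE]
        simp only [morphismRestrict_ι]
      have h2 : (𝔸(Fin r; V.toScheme) ↘ V.toScheme).appTop ≫ (c.restrictIso hV).hom.appTop =
          (π ∣_ V).appTop := by
        rw [← Scheme.Hom.comp_appTop]
        exact congrArg _ (AffineSpace.homOfVector_over _ _)
      have h3 : h (MvPolynomial.C a) = (V.topIso.inv ≫ ((𝔸(Fin r; V.toScheme) ↘
          V.toScheme).appTop ≫ (c.restrictIso hV).hom.appTop) ≫ (π ⁻¹ᵁ V).topIso.hom) a := by
        change (π ⁻¹ᵁ V).topIso.hom ((c.restrictIso hV).hom.appTop (g (f (MvPolynomial.C a)))) = _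
        rw [hg', show f (MvPolynomial.C a) = MvPolynomial.C (V.topIso.inv a) from
          MvPolynomial.map_C _ _, MvPolynomial.eval₂Hom_C]
        rfl
      rw [h2, reassoc_of% h1, Iso.inv_hom_id, Category.comp_id] at h3
      simpa using h3
    · have h3 : h (MvPolynomial.X k) = (π ⁻¹ᵁ V).topIso.hom ((c.restrictIso hV).hom.appTop
          (AffineSpace.coord _ k)) := by
        change (π ⁻¹ᵁ V).topIso.hom ((c.restrictIso hV).hom.appTop (g (f (MvPolynomial.X k)))) = _
        rw [hg', show f (MvPolynomial.X k) = MvPolynomial.X k from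
          MvPolynomial.map_X _ _, MvPolynomial.eval₂Hom_X']
      rw [restrictIso, AffineSpace.homOfVector_appTop_coord, Iso.inv_hom_id_apply] at h3
      simpa using h3
  rw [← hh]
  have : IsIso h := IsIso.comp_isIso' hf (IsIso.comp_isIso' hg
    (IsIso.comp_isIso' (Scheme.Hom.isIso_appTop _) inferInstance))
  exact ConcreteCategory.bijective_of_isIso h

end BundleChart

namespace BundleChart

variable {X E E' T : Scheme.{0}} {π : E ⟶ X} {π' : E' ⟶ X} {r r' : ℕ}

theorem id_appLE_coord (c : BundleChart π r) {V : X.Opens} (hV : V ≤ c.base) (k : Fin r) :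
    (𝟙 E : E ⟶ E).appLE (π ⁻¹ᵁ c.base) (π ⁻¹ᵁ V) (π.preimage_mono hV) (c.coord k) =
      c.coordOn hV k := by
  have h : (𝟙 E : E ⟶ E).appLE (π ⁻¹ᵁ c.base) (π ⁻¹ᵁ V) (π.preimage_mono hV) =
      E.presheaf.map (homOfLE (π.preimage_mono hV)).op := Category.id_comp _
  rw [h, coordOn]

/-! ### Matrices of linear morphisms -/

/-- In the charts `c` and `d`, the morphism `f` is given over `V` by the matrix `A`. -/
def HasMatrix (c : BundleChart π r) (d : BundleChart π' r') (f : E ⟶ E') (w : f ≫ π' = π)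
    {V : X.Opens} (hc : V ≤ c.base) (hd : V ≤ d.base) (A : Matrix (Fin r') (Fin r) Γ(X, V)) :
    Prop :=
  ∀ k, f.appLE (π' ⁻¹ᵁ d.base) (π ⁻¹ᵁ V) (by subst w; exact fun _ h => hd h) (d.coord k) =
    ∑ l, π.app V (A k l) * c.coordOn hc l

/-- The matrix formula on `T`-valued points, obtained by pulling it back along `u`. The composites
are separate variables `g` and `v`, so that other expressions for them can be supplied without
rewriting inside the open sets. -/
theorem HasMatrix.comp_appLE {c : BundleChart π r} {d : BundleChart π' r'} {f : E ⟶ E'}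
    {w : f ≫ π' = π} {V : X.Opens} {hc : V ≤ c.base} {hd : V ≤ d.base}
    {A : Matrix (Fin r') (Fin r) Γ(X, V)} (H : c.HasMatrix d f w hc hd A) (u : T ⟶ E)
    (g : T ⟶ X) (hg : u ≫ π = g) (v : T ⟶ E') (hv : u ≫ f = v)
    (O : T.Opens) (h : O ≤ g ⁻¹ᵁ V) (h' : O ≤ u ⁻¹ᵁ π ⁻¹ᵁ c.base) (h'' : O ≤ v ⁻¹ᵁ π' ⁻¹ᵁ d.base)
    (k : Fin r') :
    v.appLE (π' ⁻¹ᵁ d.base) O h'' (d.coord k) =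
      ∑ l, g.appLE V O h (A k l) * u.appLE (π ⁻¹ᵁ c.base) O h' (c.coord l) := by
  subst hg hv
  have hO : O ≤ u ⁻¹ᵁ (π ⁻¹ᵁ V) := h
  have e := congrArg (u.appLE (π ⁻¹ᵁ V) O hO) (H k)
  rw [← CommRingCat.comp_apply, Scheme.Hom.appLE_comp_appLE, map_sum] at e
  refine e.trans (Finset.sum_congr rfl fun l _ => ?_)
  rw [map_mul, ← CommRingCat.comp_apply, Scheme.Hom.app_eq_appLE, Scheme.Hom.appLE_comp_appLE,
    coordOn, ← CommRingCat.comp_apply, Scheme.Hom.map_appLE]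

theorem HasMatrix.mono {c : BundleChart π r} {d : BundleChart π' r'} {f : E ⟶ E'}
    {w : f ≫ π' = π} {V : X.Opens} {hc : V ≤ c.base} {hd : V ≤ d.base}
    {A : Matrix (Fin r') (Fin r) Γ(X, V)} (H : c.HasMatrix d f w hc hd A) {W : X.Opens}
    (hW : W ≤ V) :
    c.HasMatrix d f w (hW.trans hc) (hW.trans hd)
      (A.map (X.presheaf.map (homOfLE hW).op)) := by
  intro k
  rw [H.comp_appLE (𝟙 E) π (Category.id_comp _) f (Category.id_comp _) (π ⁻¹ᵁ W)
    (π.preimage_mono hW) (π.preimage_mono (hW.trans hc))]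
  refine Finset.sum_congr rfl fun l _ => ?_
  rw [Matrix.map_apply, ← CommRingCat.comp_apply, Scheme.Hom.app_eq_appLE, Scheme.Hom.map_appLE,
    id_appLE_coord]

/-- Pulling the formula for `f` back along `g` expresses the coordinates of `d` as `A` times the
pulled back coordinates of `c`; multiplying by `B` solves for the latter. -/
theorem HasMatrix.inv {c : BundleChart π r} {d : BundleChart π' r} {f : E ⟶ E'}
    {w : f ≫ π' = π} {V : X.Opens} {hc : V ≤ c.base} {hd : V ≤ d.base}
    {A B : Matrix (Fin r) (Fin r) Γ(X, V)} (H : c.HasMatrix d f w hc hd A) (hBA : B * A = 1)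
    (g : E' ⟶ E) (hgf : g ≫ f = 𝟙 E') (w' : g ≫ π = π') :
    d.HasMatrix c g w' hd hc B := by
  intro l
  have hle : π' ⁻¹ᵁ V ≤ g ⁻¹ᵁ (π ⁻¹ᵁ c.base) := by subst w'; exact fun _ h => hc h
  have h : ∀ k, d.coordOn hd k = ∑ m, π'.app V (A k m) *
      g.appLE (π ⁻¹ᵁ c.base) (π' ⁻¹ᵁ V) hle (c.coord m) := by
    intro k
    have h := H.comp_appLE g π' w' (𝟙 E') hgf (π' ⁻¹ᵁ V) le_rfl hle (π'.preimage_mono hd) k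
    rw [← Scheme.Hom.app_eq_appLE] at h
    rw [← h, id_appLE_coord]
  have hBA' : ∀ m, ∑ k, π'.app V (B l k) * π'.app V (A k m) = if l = m then 1 else 0 := by
    intro m
    have := congrArg (π'.app V) (congrFun (congrFun hBA l) m)
    simp only [Matrix.mul_apply, map_sum, map_mul, Matrix.one_apply] at this
    rw [this]
    split_ifs <;> simp
  simp only [h, Finset.mul_sum, ← mul_assoc]
  rw [Finset.sum_comm]
  simp only [← Finset.sum_mul, hBA']
  simp

/-- Quantifying over all smaller `W` allows a later choice of an affine neighbourhood serving
several charts at once. -/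
theorem LinearIn.exists_hasMatrix {c : BundleChart π r} {d : BundleChart π' r'} {f : E ⟶ E'}
    {w : f ≫ π' = π} (H : c.LinearIn d f w) {x : X} (hc : x ∈ c.base) (hd : x ∈ d.base) :
    ∃ V : X.Opens, x ∈ V ∧ ∀ W ≤ V, ∃ (hc : W ≤ c.base) (hd : W ≤ d.base)
      (A : Matrix (Fin r') (Fin r) Γ(X, W)), c.HasMatrix d f w hc hd A := by
  obtain ⟨V, hx, hc, hd, A, hA⟩ := H x ⟨hc, hd⟩
  exact ⟨V, hx, fun W hW => ⟨_, _, _, HasMatrix.mono (A := A) (hc := hc) (hd := hd) hA hW⟩⟩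

theorem coordOn_eq_sum {c d : BundleChart π r} {V : X.Opens} {hc : V ≤ c.base} {hd : V ≤ d.base}
    {A : Matrix (Fin r) (Fin r) Γ(X, V)}
    (H : c.HasMatrix d (𝟙 E) (Category.id_comp _) hc hd A) (k : Fin r) :
    d.coordOn hd k = ∑ l, π.app V (A k l) * c.coordOn hc l := by
  rw [← H k, id_appLE_coord]

/-! ### Linear parts of functions -/

/-- Linear parts with respect to the coordinates of a chart are compatible with restriction and
with linear changes of charts. -/
theorem isLinearPart_restrict {c d : BundleChart π r} {V W : X.Opens} {hV : V ≤ c.base}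
    (hW : W ≤ V) {hd : W ≤ d.base} {A : Matrix (Fin r) (Fin r) Γ(X, W)}
    (H : d.HasMatrix c (𝟙 E) (Category.id_comp _) hd (hW.trans hV) A) {s t : Γ(E, π ⁻¹ᵁ V)}
    (h : IsLinearPart (π.app V).hom (c.coordOn hV) s t) :
    IsLinearPart (π.app W).hom (d.coordOn hd)
      (E.presheaf.map (homOfLE (π.preimage_mono hW)).op s)
      (E.presheaf.map (homOfLE (π.preimage_mono hW)).op t) := by
  refine h.map (X.presheaf.map (homOfLE hW).op).hom
    (E.presheaf.map (homOfLE (π.preimage_mono hW)).op).hom (fun a => ?_) A fun l => ?_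
  · have := π.naturality (homOfLE hW).op
    exact (congr($this a)).symm
  · have := coordOn_eq_sum H l
    refine Eq.trans ?_ this
    simp only [coordOn]
    change (E.presheaf.map _ ≫ E.presheaf.map _) _ = _
    rw [← Functor.map_comp]
    rfl

theorem hasMatrix_one (c : BundleChart π r) {V : X.Opens} (hV : V ≤ c.base) :
    c.HasMatrix c (𝟙 E) (Category.id_comp _) hV hV 1 := by
  intro k
  rw [Finset.sum_eq_single k]
  · rw [id_appLE_coord, Matrix.one_apply_eq, map_one, one_mul]
  · intro l _ hl
    simp [Matrix.one_apply_ne hl.symm]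
  · simp

/-- A morphism given by an invertible matrix is a monomorphism. -/
theorem HasMatrix.eq_of_comp_eq {c : BundleChart π r} {d : BundleChart π' r'} {f : E ⟶ E'}
    {w : f ≫ π' = π} {V : X.Opens} {hc : V ≤ c.base} {hd : V ≤ d.base}
    {A : Matrix (Fin r') (Fin r) Γ(X, V)} (H : c.HasMatrix d f w hc hd A)
    {B : Matrix (Fin r) (Fin r') Γ(X, V)} (hBA : B * A = 1) {u u' : T ⟶ E} {g : T ⟶ X}
    (hg : ⊤ ≤ g ⁻¹ᵁ V) (hu : u ≫ π = g) (hu' : u' ≫ π = g) (h : u ≫ f = u' ≫ f) : u = u' := by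
  have hub : ⊤ ≤ u ⁻¹ᵁ (π ⁻¹ᵁ c.base) := by
    rw [← Scheme.Hom.comp_preimage, hu]; exact fun t ht => hc (hg ht)
  have hub' : ⊤ ≤ u' ⁻¹ᵁ (π ⁻¹ᵁ c.base) := by
    rw [← Scheme.Hom.comp_preimage, hu']; exact fun t ht => hc (hg ht)
  have hv : ⊤ ≤ (u ≫ f) ⁻¹ᵁ (π' ⁻¹ᵁ d.base) := by
    rw [← Scheme.Hom.comp_preimage, Category.assoc, w, hu]; exact fun t ht => hd (hg ht)
  have hBA' : B.map (g.appLE V ⊤ hg) * A.map (g.appLE V ⊤ hg) = 1 := by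
    rw [← Matrix.map_mul, hBA]; simp
  refine c.hom_ext (hu.trans hu'.symm) hub hub' fun k => ?_
  have e : (A.map (g.appLE V ⊤ hg)).mulVec
      (fun l => u.appLE (π ⁻¹ᵁ c.base) ⊤ hub (c.coord l)) = (A.map (g.appLE V ⊤ hg)).mulVec
      (fun l => u'.appLE (π ⁻¹ᵁ c.base) ⊤ hub' (c.coord l)) := by
    ext k
    exact (H.comp_appLE u g hu (u ≫ f) rfl ⊤ hg hub hv k).symm.trans
      (H.comp_appLE u' g hu' (u ≫ f) h.symm ⊤ hg hub' hv k)
  have e' := congrArg (B.map (g.appLE V ⊤ hg)).mulVec e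
  rw [Matrix.mulVec_mulVec, Matrix.mulVec_mulVec, hBA', Matrix.one_mulVec, Matrix.one_mulVec] at e'
  exact congrFun e' k

/-- Morphisms lift along a morphism given by an invertible matrix. -/
theorem HasMatrix.exists_comp_eq {c : BundleChart π r} {d : BundleChart π' r'} {f : E ⟶ E'}
    {w : f ≫ π' = π} {V : X.Opens} {hc : V ≤ c.base} {hd : V ≤ d.base}
    {A : Matrix (Fin r') (Fin r) Γ(X, V)} (H : c.HasMatrix d f w hc hd A)
    {B : Matrix (Fin r) (Fin r') Γ(X, V)} (hAB : A * B = 1) {v : T ⟶ E'} {g : T ⟶ X}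
    (hg : ⊤ ≤ g ⁻¹ᵁ V) (hv : v ≫ π' = g) : ∃ u : T ⟶ E, u ≫ π = g ∧ u ≫ f = v := by
  have hvb : ⊤ ≤ v ⁻¹ᵁ (π' ⁻¹ᵁ d.base) := by
    rw [← Scheme.Hom.comp_preimage, hv]; exact fun t ht => hd (hg ht)
  have hAB' : A.map (g.appLE V ⊤ hg) * B.map (g.appLE V ⊤ hg) = 1 := by
    rw [← Matrix.map_mul, hAB]; simp
  -- The coordinates of the lift are those of `v` multiplied by the inverse matrix.
  let a := (B.map (g.appLE V ⊤ hg)).mulVec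
    (fun l => v.appLE (π' ⁻¹ᵁ d.base) ⊤ hvb (d.coord l))
  have hgc : ∀ t, g t ∈ c.base := fun t => hc (hg trivial)
  refine ⟨c.lift g hgc a, c.lift_proj _ _ _, ?_⟩
  have hv' : ⊤ ≤ (c.lift g hgc a ≫ f) ⁻¹ᵁ (π' ⁻¹ᵁ d.base) := by
    rw [← Scheme.Hom.comp_preimage, Category.assoc, w, lift_proj]; exact fun t ht => hd (hg ht)
  refine d.hom_ext (by rw [Category.assoc, w, lift_proj, hv]) hv' hvb fun k => ?_
  rw [H.comp_appLE (c.lift g hgc a) g (c.lift_proj _ _ _) _ rfl ⊤ hg (c.lift_mem _ _ _)]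
  simp only [lift_coord]
  change (A.map (g.appLE V ⊤ hg)).mulVec a k = _
  rw [Matrix.mulVec_mulVec, hAB', Matrix.one_mulVec]

/-! ### Morphisms from open subsets of a scheme over the base -/

theorem _root_.AlgebraicGeometry.Scheme.topIso_inv_homOfLE_appTop {Y : Scheme.{0}} {V W : Y.Opens}
    (h : W ≤ V) (s : Γ(Y, V)) :
    (Y.homOfLE h).appTop (V.topIso.inv s) = W.topIso.inv (Y.presheaf.map (homOfLE h).op s) := by
  have h1 : V.topIso.inv ≫ (Y.homOfLE h).appTop =
      Y.presheaf.map (homOfLE h).op ≫ W.topIso.inv := by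
    rw [Scheme.Opens.topIso_inv_eq_appLE, Scheme.Opens.topIso_inv_eq_appLE,
      Scheme.Hom.appTop_eq_appLE, Scheme.Hom.appLE_comp_appLE, Scheme.Hom.map_appLE]
    simp only [Scheme.homOfLE_ι]
  exact congr($h1 s)

/-- The morphism `π⁻¹(V) ⟶ E'` over `V` with the coordinates `t`. -/
def liftOn (d : BundleChart π' r') (π : E ⟶ X) {V : X.Opens} (hV : V ≤ d.base)
    (t : Fin r' → Γ(E, π ⁻¹ᵁ V)) : (π ⁻¹ᵁ V).toScheme ⟶ E' :=
  d.lift ((π ⁻¹ᵁ V).ι ≫ π) (fun p => hV p.2) (fun k => (π ⁻¹ᵁ V).topIso.inv (t k))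

theorem liftOn_proj (d : BundleChart π' r') (π : E ⟶ X) {V : X.Opens} (hV : V ≤ d.base)
    (t : Fin r' → Γ(E, π ⁻¹ᵁ V)) : d.liftOn π hV t ≫ π' = (π ⁻¹ᵁ V).ι ≫ π :=
  d.lift_proj _ _ _

theorem liftOn_coord (d : BundleChart π' r') (π : E ⟶ X) {V : X.Opens} (hV : V ≤ d.base)
    (t : Fin r' → Γ(E, π ⁻¹ᵁ V)) (e) (k : Fin r') :
    (d.liftOn π hV t).appLE (π' ⁻¹ᵁ d.base) ⊤ e (d.coord k) = (π ⁻¹ᵁ V).topIso.inv (t k) :=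
  d.lift_coord _ _ _ _ _

theorem liftOn_mem (d : BundleChart π' r') (π : E ⟶ X) {V : X.Opens} (hV : V ≤ d.base)
    (t : Fin r' → Γ(E, π ⁻¹ᵁ V)) : ⊤ ≤ d.liftOn π hV t ⁻¹ᵁ (π' ⁻¹ᵁ d.base) :=
  d.lift_mem _ _ _

theorem homOfLE_liftOn (d : BundleChart π' r') (π : E ⟶ X) {V W : X.Opens} (hV : V ≤ d.base)
    (hW : W ≤ V) (t : Fin r' → Γ(E, π ⁻¹ᵁ V)) :
    E.homOfLE (π.preimage_mono hW) ≫ d.liftOn π hV t = d.liftOn π (hW.trans hV)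
      (fun k => E.presheaf.map (homOfLE (π.preimage_mono hW)).op (t k)) := by
  simp only [liftOn, comp_lift, Scheme.homOfLE_ι_assoc, Scheme.topIso_inv_homOfLE_appTop]

/-- Coordinate vectors related by the transition matrix of the target describe one morphism; this
makes the local linear maps glue. -/
theorem liftOn_congr {d d' : BundleChart π' r'} (π : E ⟶ X) {W : X.Opens} {hd : W ≤ d.base}
    {hd' : W ≤ d'.base} {B : Matrix (Fin r') (Fin r') Γ(X, W)}
    (H : d'.HasMatrix d (𝟙 E') (Category.id_comp _) hd' hd B)
    {t t' : Fin r' → Γ(E, π ⁻¹ᵁ W)} (h : ∀ k, t k = ∑ l, π.app W (B k l) * t' l) :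
    d.liftOn π hd t = d'.liftOn π hd' t' := by
  have hland : ∀ N : X.Opens, W ≤ N → ⊤ ≤ d'.liftOn π hd' t' ⁻¹ᵁ (π' ⁻¹ᵁ N) := fun N hN => by
    rw [← Scheme.Hom.comp_preimage, liftOn_proj]
    exact fun p _ => hN p.2
  have hWle : ⊤ ≤ ((π ⁻¹ᵁ W).ι ≫ π) ⁻¹ᵁ W := fun p _ => p.2
  refine d.hom_ext (by rw [liftOn_proj, liftOn_proj]) (d.liftOn_mem _ _ _) (hland _ hd) fun k => ?_
  rw [liftOn_coord, H.comp_appLE _ _ (liftOn_proj _ _ _ _) _ (Category.comp_id _) ⊤ hWle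
    (hland _ hd')]
  have h1 : ∀ a, ((π ⁻¹ᵁ W).ι ≫ π).appLE W ⊤ hWle a =
      (π ⁻¹ᵁ W).topIso.inv (π.app W a) := by
    intro a
    rw [Scheme.Opens.topIso_inv_eq_appLE, ← CommRingCat.comp_apply,
      Scheme.Hom.app_eq_appLE, Scheme.Hom.appLE_comp_appLE]
  simp only [liftOn_coord, h1, ← map_mul, ← map_sum]
  rw [h]

end BundleChart

namespace AlgVectorBundle

variable {X : Scheme.{0}} {r : ℕ}

/-! ### Linearization of isomorphisms of total spaces over the base -/

/-- An affine open set of the base over which charts of both bundles are defined. -/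
structure CommonChart (F G : AlgVectorBundle X r) where
  /-- the affine open set -/
  base : X.Opens
  /-- the chart of the first bundle -/
  fst : BundleChart F.proj r
  /-- the chart of the second bundle -/
  snd : BundleChart G.proj r
  fst_mem : fst ∈ F.atlas
  snd_mem : snd ∈ G.atlas
  le_fst : base ≤ fst.base
  le_snd : base ≤ snd.base
  isAffineOpen : IsAffineOpen base

variable {F G : AlgVectorBundle X r}

theorem CommonChart.exists_of_mem {c : BundleChart F.proj r} {d : BundleChart G.proj r}
    (hc : c ∈ F.atlas) (hd : d ∈ G.atlas) {x : X} (hxc : x ∈ c.base) (hxd : x ∈ d.base) :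
    ∃ i : CommonChart F G, i.fst = c ∧ i.snd = d ∧ x ∈ i.base := by
  obtain ⟨V, hV, hx, hle⟩ := exists_isAffineOpen_mem_and_subset (x := x) (U := c.base ⊓ d.base)
    ⟨hxc, hxd⟩
  exact ⟨⟨V, c, d, hc, hd, fun _ h => (hle h).1, fun _ h => (hle h).2, hV⟩, rfl, rfl, hx⟩

theorem CommonChart.exists_mem (F G : AlgVectorBundle X r) (x : X) :
    ∃ i : CommonChart F G, x ∈ i.base := by
  obtain ⟨c, hc, hxc⟩ := F.cover x
  obtain ⟨d, hd, hxd⟩ := G.cover x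
  obtain ⟨i, -, -, hi⟩ := CommonChart.exists_of_mem hc hd hxc hxd
  exact ⟨i, hi⟩

theorem hom_preimage_le {ψ : F.total ⟶ G.total} (w : ψ ≫ G.proj = F.proj) {V W : X.Opens}
    (h : V ≤ W) : F.proj ⁻¹ᵁ V ≤ ψ ⁻¹ᵁ (G.proj ⁻¹ᵁ W) := by
  rw [← w]
  exact fun _ hx => h hx

/-- A morphism that is given in all common charts by an invertible matrix is an isomorphism of
vector bundles. -/
theorem isomorphic_of_hasMatrix (f : F.total ⟶ G.total) (w : f ≫ G.proj = F.proj)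
    (H : ∀ i : CommonChart F G, ∃ A : Matrix (Fin r) (Fin r) Γ(X, i.base), IsUnit A ∧
      i.fst.HasMatrix i.snd f w i.le_fst i.le_snd A) : F.Isomorphic G := by
  choose A hA hfA using H
  have hAA : ∀ i, (A i)⁻¹ * A i = 1 := fun i =>
    Matrix.nonsing_inv_mul _ ((Matrix.isUnit_iff_isUnit_det _).mp (hA i))
  have hAA' : ∀ i, A i * (A i)⁻¹ = 1 := fun i =>
    Matrix.mul_nonsing_inv _ ((Matrix.isUnit_iff_isUnit_det _).mp (hA i))
  have hiso : IsIso f := by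
    refine IsZariskiLocalAtTarget.of_iSup_eq_top (P := MorphismProperty.isomorphisms Scheme)
      (fun i : CommonChart F G => G.proj ⁻¹ᵁ i.base) ?_ fun i => ?_
    · rw [eq_top_iff]
      intro y _
      obtain ⟨i, hi⟩ := CommonChart.exists_mem F G (G.proj y)
      exact TopologicalSpace.Opens.mem_iSup.mpr ⟨i, hi⟩
    · set U := G.proj ⁻¹ᵁ i.base with hU
      have hUle : ⊤ ≤ (U.ι ≫ G.proj) ⁻¹ᵁ i.base := by
        rw [Scheme.Hom.comp_preimage, U.ι_preimage_self]
      -- Lifting the inclusion of `U` along `f` gives a local right inverse `k`. It is also a left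
      -- inverse because `f` is monic on morphisms over the chart.
      obtain ⟨k, hk, hkf⟩ := (hfA i).exists_comp_eq (hAA' i) (v := U.ι) hUle rfl
      have hle : ⊤ ≤ ((f ⁻¹ᵁ U).ι ≫ F.proj) ⁻¹ᵁ i.base := by
        rw [← w, Scheme.Hom.comp_preimage, Scheme.Hom.comp_preimage, ← hU,
          (f ⁻¹ᵁ U).ι_preimage_self]
      have h1 : (f ∣_ U) ≫ k = (f ⁻¹ᵁ U).ι := by
        refine (hfA i).eq_of_comp_eq (hAA i) hle ?_ rfl ?_
        · rw [Category.assoc, hk, morphismRestrict_ι_assoc, w]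
        · rw [Category.assoc, hkf, morphismRestrict_ι]
      have hkr : Set.range k ⊆ Set.range (f ⁻¹ᵁ U).ι := by
        rw [Scheme.Opens.range_ι]
        rintro _ ⟨t, rfl⟩
        change f (k t) ∈ U
        rw [← Scheme.Hom.comp_apply, hkf]
        exact t.2
      refine ⟨IsOpenImmersion.lift (f ⁻¹ᵁ U).ι k hkr, ?_, ?_⟩
      · rw [← cancel_mono (f ⁻¹ᵁ U).ι, Category.assoc, IsOpenImmersion.lift_fac, h1,
          Category.id_comp]
      · rw [← cancel_mono U.ι, Category.assoc, morphismRestrict_ι,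
          IsOpenImmersion.lift_fac_assoc, hkf, Category.id_comp]
  have w' : inv f ≫ F.proj = G.proj := by rw [← w, IsIso.inv_hom_id_assoc]
  refine ⟨⟨f, w, fun c hc d hd x hx => ?_⟩, ⟨inv f, w', fun d hd c hc x hx => ?_⟩,
    IsIso.hom_inv_id f, IsIso.inv_hom_id f⟩
  · obtain ⟨i, rfl, rfl, hi⟩ := CommonChart.exists_of_mem hc hd hx.1 hx.2
    exact ⟨i.base, hi, i.le_fst, i.le_snd, A i, hfA i⟩
  · obtain ⟨i, rfl, rfl, hi⟩ := CommonChart.exists_of_mem hc hd hx.2 hx.1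
    exact ⟨i.base, hi, i.le_snd, i.le_fst, (A i)⁻¹,
      (hfA i).inv (hAA i) (inv f) (IsIso.inv_hom_id f) w'⟩

/-- In a common chart, `A` is the matrix of the linear part of `ψ`. -/
def CommonChart.IsLinearPartMatrix (i : CommonChart F G) (ψ : F.total ⟶ G.total)
    (w : ψ ≫ G.proj = F.proj) (A : Matrix (Fin r) (Fin r) Γ(X, i.base)) : Prop :=
  ∀ k, IsLinearPart (F.proj.app i.base).hom (i.fst.coordOn i.le_fst)
    (ψ.appLE (G.proj ⁻¹ᵁ i.snd.base) (F.proj ⁻¹ᵁ i.base) (hom_preimage_le w i.le_snd)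
      (i.snd.coord k))
    (∑ l, F.proj.app i.base (A k l) * i.fst.coordOn i.le_fst l)

theorem CommonChart.exists_isLinearPartMatrix (i : CommonChart F G) (ψ : F.total ⟶ G.total)
    (w : ψ ≫ G.proj = F.proj) : ∃ A, i.IsLinearPartMatrix ψ w A := by
  have hex : ∀ (k : Fin r), ∃ a : Fin r → Γ(X, i.base),
      IsLinearPart (F.proj.app i.base).hom (i.fst.coordOn i.le_fst)
        (ψ.appLE (G.proj ⁻¹ᵁ i.snd.base) (F.proj ⁻¹ᵁ i.base) (hom_preimage_le w i.le_snd)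
          (i.snd.coord k))
        (∑ l, F.proj.app i.base (a l) * i.fst.coordOn i.le_fst l) := fun k =>
    IsLinearPart.exists_eq_sum (i.fst.bijective_eval₂Hom i.le_fst i.isAffineOpen).2 _
  choose A hA using hex
  exact ⟨Matrix.of A, hA⟩

/-- The morphism given by a matrix in a common chart. -/
def CommonChart.linearMap (i : CommonChart F G) (A : Matrix (Fin r) (Fin r) Γ(X, i.base)) :
    (F.proj ⁻¹ᵁ i.base).toScheme ⟶ G.total :=
  i.snd.liftOn F.proj i.le_snd
    (fun k => ∑ l, F.proj.app i.base (A k l) * i.fst.coordOn i.le_fst l)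

/-- The linear part of a morphism is independent of the common chart. -/
theorem CommonChart.exists_homOfLE_linearMap_eq (i j : CommonChart F G) (ψ : F.total ⟶ G.total)
    (w : ψ ≫ G.proj = F.proj) {A : Matrix (Fin r) (Fin r) Γ(X, i.base)}
    (hA : i.IsLinearPartMatrix ψ w A) {A' : Matrix (Fin r) (Fin r) Γ(X, j.base)}
    (hA' : j.IsLinearPartMatrix ψ w A') {x : X} (hi : x ∈ i.base) (hj : x ∈ j.base) :
    ∃ (W : X.Opens) (_ : x ∈ W) (hi : W ≤ i.base) (hj : W ≤ j.base),
      F.total.homOfLE (F.proj.preimage_mono hi) ≫ i.linearMap A =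
        F.total.homOfLE (F.proj.preimage_mono hj) ≫ j.linearMap A' := by
  obtain ⟨V₁, hV₁, H₁⟩ := (F.transition i.fst i.fst_mem j.fst j.fst_mem).exists_hasMatrix
    (i.le_fst hi) (j.le_fst hj)
  obtain ⟨V₂, hV₂, H₂⟩ := (G.transition j.snd j.snd_mem i.snd i.snd_mem).exists_hasMatrix
    (j.le_snd hj) (i.le_snd hi)
  obtain ⟨W, hW, hxW, hle⟩ := exists_isAffineOpen_mem_and_subset (x := x)
    (U := i.base ⊓ j.base ⊓ (V₁ ⊓ V₂)) ⟨⟨hi, hj⟩, hV₁, hV₂⟩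
  have hWi : W ≤ i.base := fun _ h => (hle h).1.1
  have hWj : W ≤ j.base := fun _ h => (hle h).1.2
  obtain ⟨_, _, A₁, HA₁⟩ := H₁ W fun _ h => (hle h).2.1
  obtain ⟨_, _, B, HB⟩ := H₂ W fun _ h => (hle h).2.2
  refine ⟨W, hxW, hWi, hWj, ?_⟩
  rw [linearMap, linearMap, BundleChart.homOfLE_liftOn _ _ _ hWi,
    BundleChart.homOfLE_liftOn _ _ _ hWj]
  refine BundleChart.liftOn_congr F.proj HB fun k => ?_
  -- Both sides are linear parts, in the coordinates of `i.fst`, of the same function: the pullback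
  -- by `ψ` of a coordinate of `i.snd`. Uniqueness requires `W` to be affine.
  refine IsLinearPart.unique (i.fst.bijective_eval₂Hom (hWi.trans i.le_fst) hW).1
    (BundleChart.isLinearPart_restrict hWi (i.fst.hasMatrix_one _) (hA k)) ?_
  have h3 := IsLinearPart.sum_mul Finset.univ (B k) fun l _ =>
    BundleChart.isLinearPart_restrict hWj HA₁ (hA' l)
  convert h3 using 1
  rw [← CommRingCat.comp_apply, Scheme.Hom.appLE_map,
    HB.comp_appLE ψ F.proj w ψ (Category.comp_id _) (F.proj ⁻¹ᵁ W) le_rfl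
      (hom_preimage_le w (hWj.trans j.le_snd))]
  refine Finset.sum_congr rfl fun l _ => ?_
  rw [← Scheme.Hom.app_eq_appLE, ← CommRingCat.comp_apply, Scheme.Hom.appLE_map]

/-- The linear part of a morphism of total spaces over the base. -/
theorem exists_linearPart (ψ : F.total ⟶ G.total) (w : ψ ≫ G.proj = F.proj) :
    ∃ (f : F.total ⟶ G.total) (w' : f ≫ G.proj = F.proj), ∀ i : CommonChart F G,
      ∃ A : Matrix (Fin r) (Fin r) Γ(X, i.base),
        i.fst.HasMatrix i.snd f w' i.le_fst i.le_snd A ∧ i.IsLinearPartMatrix ψ w A := by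
  choose A hA using fun i : CommonChart F G => i.exists_isLinearPartMatrix ψ w
  obtain ⟨f, hf⟩ := Scheme.exists_glue (fun i : CommonChart F G => F.proj ⁻¹ᵁ i.base)
    (fun y => CommonChart.exists_mem F G (F.proj y)) (fun i => i.linearMap (A i)) (by
      intro i j y hy
      obtain ⟨W, hW, hi, hj, e⟩ := i.exists_homOfLE_linearMap_eq j ψ w (hA i) (hA j) hy.1 hy.2
      exact ⟨F.proj ⁻¹ᵁ W, hW, F.proj.preimage_mono hi, F.proj.preimage_mono hj, e⟩)
  have w' : f ≫ G.proj = F.proj := by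
    refine Scheme.hom_ext_of_forall _ _ fun y => ?_
    obtain ⟨i, hi⟩ := CommonChart.exists_mem F G (F.proj y)
    refine ⟨F.proj ⁻¹ᵁ i.base, hi, ?_⟩
    rw [reassoc_of% hf i, CommonChart.linearMap, BundleChart.liftOn_proj]
  refine ⟨f, w', fun i => ⟨A i, fun k => ?_, hA i⟩⟩
  have h1 := i.snd.liftOn_coord F.proj i.le_snd
    (fun k => ∑ l, F.proj.app i.base (A i k l) * i.fst.coordOn i.le_fst l)
    (i.snd.liftOn_mem _ _ _) k
  have h2 : ∀ e, ((F.proj ⁻¹ᵁ i.base).ι ≫ f).appLE (G.proj ⁻¹ᵁ i.snd.base) ⊤ e =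
      f.appLE _ _ (hom_preimage_le w' i.le_snd) ≫ (F.proj ⁻¹ᵁ i.base).topIso.inv := fun e => by
    rw [Scheme.Opens.topIso_inv_eq_appLE, Scheme.Hom.appLE_comp_appLE]
  change (i.linearMap (A i)).appLE _ _ _ _ = _ at h1
  simp only [← hf i, h2] at h1
  exact (ConcreteCategory.bijective_of_isIso (F.proj ⁻¹ᵁ i.base).topIso.inv).1 h1

/-- Vector bundles whose total spaces are isomorphic over the base are isomorphic. -/
theorem isomorphic_of_iso (ψ : F.total ≅ G.total) (w : ψ.hom ≫ G.proj = F.proj) :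
    F.Isomorphic G := by
  obtain ⟨f, w', H⟩ := exists_linearPart ψ.hom w
  refine isomorphic_of_hasMatrix f w' fun i => ?_
  obtain ⟨A, hA, hA'⟩ := H i
  refine ⟨A, ?_, hA⟩
  have w'' : ψ.inv ≫ F.proj = G.proj := by rw [← w, Iso.inv_hom_id_assoc]
  -- Pullback along `ψ` identifies the two rings of functions over `i.base`, compatibly with the
  -- functions on the base.
  let φ : Γ(G.total, G.proj ⁻¹ᵁ i.base) ≅ Γ(F.total, F.proj ⁻¹ᵁ i.base) :=
    { hom := ψ.hom.appLE _ _ (hom_preimage_le w le_rfl)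
      inv := ψ.inv.appLE _ _ (hom_preimage_le w'' le_rfl)
      hom_inv_id := by
        rw [Scheme.Hom.appLE_comp_appLE]
        simp only [Iso.inv_hom_id]
        exact (Category.id_comp _).trans (G.total.presheaf.map_id _)
      inv_hom_id := by
        rw [Scheme.Hom.appLE_comp_appLE]
        simp only [Iso.hom_inv_id]
        exact (Category.id_comp _).trans (F.total.presheaf.map_id _) }
  refine IsLinearPart.isUnit_matrix (i.fst.bijective_eval₂Hom i.le_fst i.isAffineOpen)
    (i.snd.bijective_eval₂Hom i.le_snd i.isAffineOpen) φ.commRingCatIsoToRingEquiv (fun a => ?_)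
    A fun k => ?_
  · change (G.proj.app _ ≫ ψ.hom.appLE _ _ _) a = _
    rw [Scheme.Hom.app_eq_appLE, Scheme.Hom.appLE_comp_appLE]
    simp only [w, ← Scheme.Hom.app_eq_appLE]
  · convert hA' k using 1
    change (G.total.presheaf.map _ ≫ ψ.hom.appLE _ _ _) _ = _
    rw [Scheme.Hom.map_appLE]

end AlgVectorBundle

/-! ### Points that lie on no polynomial curve -/

/-- In a `T₀` space of dimension less than one, there are no proper specializations. -/
theorem Specializes.eq_of_topologicalKrullDim_lt_one {X : Type*} [TopologicalSpace X] [T0Space X]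
    (h : topologicalKrullDim X < 1) {x y : X} (hxy : x ⤳ y) : x = y := by
  by_contra hne
  refine absurd h (not_lt.mpr ?_)
  let a : TopologicalSpace.IrreducibleCloseds X :=
    ⟨closure {y}, isIrreducible_singleton.closure, isClosed_closure⟩
  let b : TopologicalSpace.IrreducibleCloseds X :=
    ⟨closure {x}, isIrreducible_singleton.closure, isClosed_closure⟩
  have hab : a < b := by
    refine lt_of_le_of_ne (fun z hz => ?_) fun hab => hne ?_
    · exact hxy.closure_subset hz
    · have : closure {y} = closure {x} := congrArg TopologicalSpace.IrreducibleCloseds.carrier hab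
      exact (hxy.antisymm (specializes_iff_closure_subset.mpr this.ge)).eq
  exact Order.one_le_krullDim_iff.mpr ⟨a, b, hab⟩

/-- The closed points of `X` that lie on no polynomial curve. -/
def curveFreePoints (X : Over SpecC) : Set X.left :=
  {x | IsClosed {x} ∧ ∀ C, IsPolynomialCurve X C → x ∉ C}

/-- In dimension at least one this is the negation of uniruledness applied to `U`. In lower
dimension there are no proper specializations, so the irreducible affine line has only constant
images and any closed point serves. -/
theorem exists_mem_curveFreePoints {X : Over SpecC} [LocallyOfFiniteType X.hom]
    (hX : ¬ IsCUniruled X) (U : X.left.Opens) (hU : (U : Set X.left).Nonempty) :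
    ∃ x ∈ U, x ∈ curveFreePoints X := by
  by_cases hdim : 1 ≤ topologicalKrullDim X.left
  · by_contra! H
    refine hX ⟨hdim, U, hU, fun x hx hx' => ?_⟩
    by_contra! hC
    exact H x hx ⟨hx', hC⟩
  · have : JacobsonSpace X.left := LocallyOfFiniteType.jacobsonSpace X.hom
    obtain ⟨x, hx, hx'⟩ := nonempty_inter_closedPoints hU U.isOpen.isLocallyClosed
    refine ⟨x, hx, hx', ?_⟩
    rintro C ⟨φ, ⟨p, q, hpq⟩, rfl⟩
    have : IrreducibleSpace affineLineC.left :=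
      inferInstanceAs (IrreducibleSpace 𝔸(Fin 1; SpecC))
    have h : ∀ p, φ.left (genericPoint affineLineC.left) = φ.left p := fun p =>
      ((genericPoint_specializes p).map φ.left.continuous).eq_of_topologicalKrullDim_lt_one
        (not_le.mp hdim)
    exact absurd ((h p).symm.trans (h q)) hpq

/-- The `ℂ`-point of the affine line with coordinate `a`. -/
def affineLinePoint (a : Γ(SpecC, ⊤)) : SpecC ⟶ affineLineC.left :=
  AffineSpace.homOfVector (𝟙 _) fun _ => a

theorem affineLinePoint_hom (a : Γ(SpecC, ⊤)) : affineLinePoint a ≫ affineLineC.hom = 𝟙 _ :=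
  AffineSpace.homOfVector_over _ _

/-- The coordinate of the affine line. -/
def affineLineCoord : Γ(affineLineC.left, ⊤) := AffineSpace.coord SpecC 0

theorem affineLinePoint_coord (a : Γ(SpecC, ⊤)) :
    (affineLinePoint a).appTop affineLineCoord = a :=
  AffineSpace.homOfVector_appTop_coord _ _ _

/-! ### Constancy along the fibres. -/

namespace BundleChart

variable {X E : Scheme.{0}} {π : E ⟶ X} {r : ℕ}

theorem ι_mem_base (c : BundleChart π r) (x : c.base.toScheme) : c.base.ι x ∈ c.base := x.2

/-- The zero section over the domain of a chart. -/
def zeroSection (c : BundleChart π r) : c.base.toScheme ⟶ E :=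
  c.lift c.base.ι c.ι_mem_base 0

theorem zeroSection_proj (c : BundleChart π r) : c.zeroSection ≫ π = c.base.ι :=
  c.lift_proj _ _ _

/-- The line through the origin and a `ℂ`-point of a fibre. -/
theorem exists_line (c : BundleChart π r) (p : SpecC ⟶ (π ⁻¹ᵁ c.base).toScheme) :
    ∃ γ : affineLineC.left ⟶ E, γ ≫ π = affineLineC.hom ≫ p ≫ (π ⁻¹ᵁ c.base).ι ≫ π ∧
      affineLinePoint 1 ≫ γ = p ≫ (π ⁻¹ᵁ c.base).ι ∧
      affineLinePoint 0 ≫ γ = p ≫ (π ∣_ c.base) ≫ c.zeroSection := by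
  have hp : ∀ z, ((p ≫ (π ⁻¹ᵁ c.base).ι) ≫ π) z ∈ c.base := fun z => (p z).2
  have hp' : ⊤ ≤ (p ≫ (π ⁻¹ᵁ c.base).ι) ⁻¹ᵁ (π ⁻¹ᵁ c.base) := fun z _ => hp z
  let e : Fin r → Γ(SpecC, ⊤) := fun k => (p ≫ (π ⁻¹ᵁ c.base).ι).appLE _ ⊤ hp' (c.coord k)
  -- The line is `t ↦ t • e` in the fibre with coordinates `e`: `a = 1` gives back the point and `a
  -- = 0` the origin.
  have hlift : ∀ a, affineLinePoint a ≫ c.lift (affineLineC.hom ≫ (p ≫ (π ⁻¹ᵁ c.base).ι) ≫ π)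
      (fun t => by rw [Scheme.Hom.comp_apply]; exact hp _)
      (fun k => affineLineCoord * affineLineC.hom.appTop (e k)) =
      c.lift ((p ≫ (π ⁻¹ᵁ c.base).ι) ≫ π) hp (fun k => a * e k) := fun a => by
    have h1 : ∀ s, (affineLinePoint a).appTop (affineLineC.hom.appTop s) = s := fun s => by
      rw [← CommRingCat.comp_apply, ← Scheme.Hom.comp_appTop, affineLinePoint_hom]
      simp
    simp only [comp_lift, map_mul, affineLinePoint_coord, h1]
    congr 1
    rw [reassoc_of% affineLinePoint_hom]
  refine ⟨_, ?_, (hlift 1).trans ?_, (hlift 0).trans ?_⟩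
  · rw [lift_proj, Category.assoc]
  · refine c.hom_ext (c.lift_proj _ _ _) (c.lift_mem _ _ _) hp' fun k => ?_
    rw [lift_coord, one_mul]
  · rw [← Category.assoc, zeroSection, comp_lift]
    congr 1
    · simp
    · ext k
      simp

theorem locallyOfFiniteType_restrict (c : BundleChart π r) :
    LocallyOfFiniteType (π ∣_ c.base) := by
  rw [← c.triv_over]
  infer_instance

/-- A morphism to a variety in which the points on no polynomial curve are dense is constant on
the fibres of a vector bundle, over the domain of a chart. -/
theorem ι_comp_eq_zeroSection {X Y : Over SpecC} {E : Scheme.{0}} {π : E ⟶ X.left}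
    [IsReduced X.left] [LocallyOfFiniteType X.hom] [LocallyOfFiniteType Y.hom]
    [IsSeparated Y.hom] (hY : ¬ IsCUniruled Y) (c : BundleChart π r) (f : E ⟶ Y.left)
    (w : f ≫ Y.hom = π ≫ X.hom) (hf : IsOpenMap f) :
    (π ⁻¹ᵁ c.base).ι ≫ f = (π ∣_ c.base) ≫ c.zeroSection ≫ f := by
  let T := (π ⁻¹ᵁ c.base).toScheme
  let q : T ⟶ SpecC := (π ∣_ c.base) ≫ c.base.ι ≫ X.hom
  have hπ := c.locallyOfFiniteType_restrict
  have : LocallyOfFiniteType q := inferInstance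
  have : JacobsonSpace T := LocallyOfFiniteType.jacobsonSpace q
  have : IsReduced T := isReduced_of_isOpenImmersion c.triv.hom
  have hq1 : ((π ⁻¹ᵁ c.base).ι ≫ f) ≫ Y.hom = q := by
    simp [q, w]
  have hq2 : ((π ∣_ c.base) ≫ c.zeroSection ≫ f) ≫ Y.hom = q := by
    rw [Category.assoc, Category.assoc, w, reassoc_of% c.zeroSection_proj]
  -- With reduced source and separated target, it suffices to compare the morphisms at a dense set
  -- of points.
  refine ext_of_fromSpecResidueField_eq _ _ Y.hom
    {e : T | IsClosed {e} ∧ ((π ⁻¹ᵁ c.base).ι ≫ f) e ∈ curveFreePoints Y} ?_ ?_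
    (hq1.trans hq2.symm)
  · rw [dense_iff_inter_open]
    intro O hO hO'
    have hopen : IsOpenMap ((π ⁻¹ᵁ c.base).ι ≫ f) := by
      rw [Scheme.Hom.comp_base]
      exact hf.comp (π ⁻¹ᵁ c.base).ι.isOpenEmbedding.isOpenMap
    obtain ⟨y, ⟨e, he, rfl⟩, hy⟩ := exists_mem_curveFreePoints hY
      ⟨((π ⁻¹ᵁ c.base).ι ≫ f) '' O, hopen O hO⟩ (hO'.image _)
    -- The point of `O` found so far need not be closed. Its fibre is closed, so the Jacobson
    -- property supplies a closed point of `O` with the same image.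
    obtain ⟨e', ⟨he', hey⟩, hec⟩ := nonempty_inter_closedPoints (X := T)
      (Z := O ∩ ((π ⁻¹ᵁ c.base).ι ≫ f) ⁻¹' {((π ⁻¹ᵁ c.base).ι ≫ f) e}) ⟨e, he, rfl⟩
      (hO.isLocallyClosed.inter (hy.1.preimage (Scheme.Hom.continuous _)).isLocallyClosed)
    refine ⟨e', he', hec, ?_⟩
    rw [show ((π ⁻¹ᵁ c.base).ι ≫ f) e' = _ from hey]
    exact hy
  · rintro e ⟨hec, -, hcurve⟩
    rw [← cancel_epi (Spec.map (residueFieldIsoBase q e hec).hom)]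
    suffices H : pointOfClosedPoint q e hec ≫ (π ⁻¹ᵁ c.base).ι ≫ f =
        pointOfClosedPoint q e hec ≫ (π ∣_ c.base) ≫ c.zeroSection ≫ f by
      simpa only [pointOfClosedPoint, Category.assoc] using H
    set p := pointOfClosedPoint q e hec
    have hp : p ≫ q = 𝟙 _ := pointOfClosedPoint_comp q e hec
    -- The residue field at a closed point is `ℂ`, so both sides are `ℂ`-points and are determined
    -- by their images.
    refine ext_of_apply_closedPoint_eq Y.hom (by rw [Category.assoc, hq1, hp])
      (by rw [Category.assoc, hq2, hp]) ?_
    suffices H : ∀ z : SpecC, (p ≫ (π ⁻¹ᵁ c.base).ι ≫ f) z =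
      (p ≫ (π ∣_ c.base) ≫ c.zeroSection ≫ f) z from H _
    intro z
    obtain ⟨γ, hγ, hγ1, hγ0⟩ := c.exists_line p
    have hφ : (γ ≫ f) ≫ Y.hom = affineLineC.hom := by
      rw [Category.assoc, w, reassoc_of% hγ, ← morphismRestrict_ι_assoc, hp, Category.comp_id]
    let φ : affineLineC ⟶ Y := Over.homMk (γ ≫ f) hφ
    -- A non-constant `φ` would give a polynomial curve through the image of `e`, reached at
    -- parameter `1`.
    have hconst : ∀ a b, φ.left a = φ.left b := by
      by_contra! h
      refine hcurve _ ⟨φ, h, rfl⟩ ⟨affineLinePoint 1 z, ?_⟩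
      change (γ ≫ f) _ = _
      rw [← Scheme.Hom.comp_apply, reassoc_of% hγ1, Scheme.Hom.comp_apply]
      exact congrArg _ (pointOfClosedPoint_apply q e hec z)
    have := hconst (affineLinePoint 1 z)
      (affineLinePoint 0 z)
    change (γ ≫ f) _ = (γ ≫ f) _ at this
    rwa [← Scheme.Hom.comp_apply, ← Scheme.Hom.comp_apply, reassoc_of% hγ1, reassoc_of% hγ0]
      at this

end BundleChart

/-! ### Descent of morphisms from the total space to the base. -/

namespace AlgVectorBundle

variable {X Z : Scheme.{0}} {r : ℕ}

theorem isOpenMap_proj (F : AlgVectorBundle X r) : IsOpenMap F.proj := by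
  refine IsZariskiLocalAtTarget.of_iSup_eq_top (P := topologically @IsOpenMap)
    (fun c : F.atlas => c.1.base) ?_ fun c => ?_
  · rw [eq_top_iff]
    intro x _
    obtain ⟨c, hc, hx⟩ := F.cover x
    exact TopologicalSpace.Opens.mem_iSup.mpr ⟨⟨c, hc⟩, hx⟩
  · change IsOpenMap (F.proj ∣_ c.1.base)
    rw [← c.1.triv_over, Scheme.Hom.comp_base]
    exact (AffineSpace.isOpenMap_over _).comp c.1.triv.hom.isOpenEmbedding.isOpenMap

/-- The projection is an epimorphism because the zero sections of the charts split it locally. -/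
theorem eq_of_proj_comp_eq (F : AlgVectorBundle X r) {a b : X ⟶ Z}
    (h : F.proj ≫ a = F.proj ≫ b) : a = b := by
  refine Scheme.hom_ext_of_forall _ _ fun x => ?_
  obtain ⟨c, -, hx⟩ := F.cover x
  refine ⟨c.base, hx, ?_⟩
  rw [← c.zeroSection_proj, Category.assoc, Category.assoc, h]

/-- A morphism that is locally constant along the fibres descends to the base. -/
theorem exists_proj_comp_eq (F : AlgVectorBundle X r) (f : F.total ⟶ Z)
    (h : ∀ c ∈ F.atlas,
      (F.proj ⁻¹ᵁ c.base).ι ≫ f = (F.proj ∣_ c.base) ≫ c.zeroSection ≫ f) :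
    ∃ τ : X ⟶ Z, F.proj ≫ τ = f := by
  obtain ⟨τ, hτ⟩ := Scheme.exists_glue (fun c : F.atlas => c.1.base)
    (fun x => by obtain ⟨c, hc, hx⟩ := F.cover x; exact ⟨⟨c, hc⟩, hx⟩)
    (fun c => c.1.zeroSection ≫ f) (by
      intro c d x hx
      refine ⟨_, hx, inf_le_left, inf_le_right, ?_⟩
      -- The zero section of `c` need not be compared with that of `d`. It is a section lying in the
      -- domain of `d`, where `f` depends only on the base point.
      let s := X.homOfLE (inf_le_left : c.1.base ⊓ d.1.base ≤ c.1.base) ≫ c.1.zeroSection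
      have hs : s ≫ F.proj = (c.1.base ⊓ d.1.base).ι := by
        simp [s, BundleChart.zeroSection_proj]
      have hsr : Set.range s ⊆ Set.range (F.proj ⁻¹ᵁ d.1.base).ι := by
        rw [Scheme.Opens.range_ι]
        rintro _ ⟨t, rfl⟩
        change F.proj (s t) ∈ d.1.base
        rw [← Scheme.Hom.comp_apply, hs]
        exact t.2.2
      let s' := IsOpenImmersion.lift (F.proj ⁻¹ᵁ d.1.base).ι s hsr
      have hs' : s' ≫ (F.proj ⁻¹ᵁ d.1.base).ι = s := IsOpenImmersion.lift_fac _ _ _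
      have hs'' : s' ≫ (F.proj ∣_ d.1.base) = X.homOfLE inf_le_right := by
        rw [← cancel_mono d.1.base.ι, Category.assoc, morphismRestrict_ι, reassoc_of% hs', hs,
          Scheme.homOfLE_ι]
      rw [← Category.assoc]
      change s ≫ f = _
      rw [← hs', Category.assoc, h d.1 d.2, reassoc_of% hs''])
  refine ⟨τ, Scheme.hom_ext_of_forall _ _ fun y => ?_⟩
  obtain ⟨c, hc, hy⟩ := F.cover (F.proj y)
  refine ⟨F.proj ⁻¹ᵁ c.base, hy, ?_⟩
  rw [h c hc, ← hτ ⟨c, hc⟩, morphismRestrict_ι_assoc]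

/-- An isomorphism of total spaces of vector bundles covers a morphism of the base, if the base
is not uniruled. -/
theorem exists_base_hom {X : Over SpecC} [IsReduced X.left] [LocallyOfFiniteType X.hom]
    [IsSeparated X.hom] (hX : ¬ IsCUniruled X) {F G : AlgVectorBundle X.left r}
    (φ : F.total ⟶ G.total) [IsIso φ] (hφ : φ ≫ G.proj ≫ X.hom = F.proj ≫ X.hom) :
    ∃ τ : X ⟶ X, F.proj ≫ τ.left = φ ≫ G.proj := by
  have hopen : IsOpenMap (φ ≫ G.proj) := by
    rw [Scheme.Hom.comp_base]
    exact G.isOpenMap_proj.comp φ.isOpenEmbedding.isOpenMap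
  obtain ⟨τ, hτ⟩ := F.exists_proj_comp_eq (φ ≫ G.proj) fun c _ =>
    BundleChart.ι_comp_eq_zeroSection hX c _ ((Category.assoc _ _ _).trans hφ) hopen
  refine ⟨Over.homMk τ (F.eq_of_proj_comp_eq ?_), hτ⟩
  rw [reassoc_of% hτ, hφ]

end AlgVectorBundle

end

/-! ### The main theorem. -/

theorem mainTheorem4 (X : Over SpecC) [IsAffine X.left] [IsReduced X.left] [Smooth X.hom]
    (hX : ¬ IsCUniruled X) (r : ℕ) (F G : AlgVectorBundle X.left r)
    (hFG : Nonempty (F.totalSpace ≅ G.totalSpace)) :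
    ∃ σ : X ≅ X, F.Isomorphic (G.pullback σ.hom.left) := by
  obtain ⟨Φ⟩ := hFG
  let φ : F.total ≅ G.total := (Over.forget SpecC).mapIso Φ
  have hφ : φ.hom ≫ G.proj ≫ X.hom = F.proj ≫ X.hom := Over.w Φ.hom
  have hφ' : φ.inv ≫ F.proj ≫ X.hom = G.proj ≫ X.hom := Over.w Φ.inv
  obtain ⟨τ, hτ⟩ := AlgVectorBundle.exists_base_hom hX φ.hom hφ
  obtain ⟨τ', hτ'⟩ := AlgVectorBundle.exists_base_hom hX φ.inv hφ'
  let σ : X ≅ X := ⟨τ, τ', by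
    ext1
    refine F.eq_of_proj_comp_eq ?_
    rw [Over.comp_left, reassoc_of% hτ, hτ', Iso.hom_inv_id_assoc]
    exact (Category.comp_id _).symm, by
    ext1
    refine G.eq_of_proj_comp_eq ?_
    rw [Over.comp_left, reassoc_of% hτ', hτ, Iso.inv_hom_id_assoc]
    exact (Category.comp_id _).symm⟩
  refine ⟨σ, ?_⟩
  have : IsIso (C := Scheme) σ.hom.left :=
    inferInstanceAs (IsIso ((Over.forget SpecC).mapIso σ).hom)
  -- A commutative square with invertible horizontal sides is cartesian, so `F.total` is the total
  -- space of `σ^*G`, compatibly with the projections to `X`.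
  have hpb : IsPullback φ.hom F.proj G.proj σ.hom.left := IsPullback.of_horiz_isIso ⟨hτ.symm⟩
  exact AlgVectorBundle.isomorphic_of_iso (G := G.pullback σ.hom.left) hpb.isoPullback
    hpb.isoPullback_hom_snd
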